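/- **Setting.** For each sample size $n$, observe $(X_i,Y_i)$, $1\le i\le n$, from $$Y_i=\mu_i^\star+X_i^T\beta^\star+\epsilon_i ,$$ where $X_1,\dots,X_n$ are i.i.d. copies of a random vector $X_0\in\mathbb R^{d}$ with mean zero and positive definite covariance matrix $\Sigma_X$, independent of $\epsilon_1,\dots,\epsilon_n$, which are i.i.d. copies of $\epsilon_0$ with mean zero and variance $\sigma^2$. The dimension $d=d_n$ satisfies $d\to\infty$ and $d=o(n)$; $\beta^\star$, $\mu^\star$ and the law of $X_0$ may depend on $n$, the law of $\epsilon_0$ does not. Write $u_n\ll v_n$ for $u_n=o(v_n)$. There are positive sequences $\kappa_n,\gamma_n\ll\sqrt n$ with $$P\big(\max_{1\le i\le n}\|X_i\|_2>\kappa_n\big)\to0,\qquad P\big(\max_{1\le i\le n}|\epsilon_i|>\gamma_n\big)\to0 .$$ The deterministic incidental parameters are of three kinds, with $s=s_1+s_2\le n$ and $s_1,s_2=o(n)$: $\max\{\kappa_n,\gamma_n\}\ll\min_{1\le i\le s_1}|\mu_i^\star|$; $0<|\mu_i^\star|\le\gamma_n$ for $s_1<i\le s$; and $\mu_i^\star=0$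 for $s<i\le n$. The regularization parameter $\lambda=\lambda_n$ satisfies, for a constant $\alpha>2$, $$\sqrt d\,\kappa_n\ll\lambda,\qquad \alpha\gamma_n\le\lambda,\qquad \lambda\ll\min_{1\le i\le s_1}|\mu_i^\star| .$$ (Conditions on the minimum over $i\le s_1$ are void when $s_1=0$.) **Estimators.** Let $(\hat\mu,\hat\beta)$ be a measurable minimizer of $$L(\mu,\beta)=\sum_{i=1}^n (Y_i-\mu_i-X_i^T\beta)^2+\sum_{i=1}^n 2\lambda|\mu_i|$$ over $\mathbb R^n\times\mathbb R^d$, let $\hat I_0=\{i:\hat\mu_i=0\}$, and let the two-step estimator be $$\tilde\beta=(X_{\hat I_0}^TX_{\hat I_0})^{-1}X_{\hat I_0}^TY_{\hat I_0},$$ where $X_{\hat I_0}$ has the rows $X_i^T$, $i\in\hat I_0$, and $Y_{\hat I_0}$ the entries $Y_i$, $i\in\hat I_0$ (with any convention, say $\tilde\beta=0$, when the matrix is singular). **Assumptions.** Let $\|\cdot\|_F$ be the Frobenius norm, $q$ a fixed integer, $A_n$ deterministic $q\times d$ matrices, $G_n=A_nA_n^T$ and $G_{X,n}=A_n\Sigma_X^{-1}A_n^T$.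 As $n\to\infty$: * (B1') $\lambda_{\min}(\Sigma_X)$ is bounded away from zero; * (B2) $d^{-1/2}\|\Sigma_X\|_F$ is bounded; * (C) the coordinates of $X_0$ have finite fourth moments and $d^{-1}\sum_{j=1}^d(\mathbb E X_{0j}^4)^{1/2}$ is bounded; * (D) $\|A_n\|_F$ and $\lambda_{\max}(G_n)$ are bounded, and $\|G_{X,n}-G_X\|_F\to0$ for a symmetric $q\times q$ matrix $G_X$; * (E) $\max_{j}\mathrm{Var}(X_{0j})$ and $\max_{j}\mathbb E|X_{0j}|^3$ are bounded, and $\min_{j}\mathrm{Var}(X_{0j})$ is bounded away from zero. **Theorem 5.5.** Under these assumptions, if $d^5\log d=o(n)$ and $s_2=o\big(\sqrt n/(\sqrt d\,\kappa_n\gamma_n)\big)$, then $$\sqrt n\,A_n(\tilde\beta-\beta^\star)\ \overset{d}{\longrightarrow}\ N(0,\sigma^2G_X).$$ -/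

import Mathlib

open MeasureTheory ProbabilityTheory Filter Asymptotics Topology Matrix

namespace IncidentalRegression

noncomputable section

/-- The covariance matrix of a distribution `ξ` on `ℝᵈ` (the distribution of a covariate vector). -/
def covMat {d : ℕ} (ξ : Measure (EuclideanSpace ℝ (Fin d))) : Matrix (Fin d) (Fin d) ℝ :=
  Matrix.of fun j k => cov[fun x => x j, fun x => x k; ξ]

/-- The Frobenius norm of a real matrix. -/
def normF {m n : ℕ} (M : Matrix (Fin m) (Fin n) ℝ) : ℝ :=
  Real.sqrt (∑ i, ∑ j, M i j ^ 2)

/-- The rescaled Frobenius norm `d^(-1/2) ‖M‖_F` of a `d × d` matrix. -/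
def normFd {d : ℕ} (M : Matrix (Fin d) (Fin d) ℝ) : ℝ :=
  (Real.sqrt d)⁻¹ * normF M

/-- The smallest (real) eigenvalue of a real symmetric matrix. -/
def lamMin {d : ℕ} (M : Matrix (Fin d) (Fin d) ℝ) : ℝ := sInf (spectrum ℝ M)

/-- The largest (real) eigenvalue of a real symmetric matrix. -/
def lamMax {d : ℕ} (M : Matrix (Fin d) (Fin d) ℝ) : ℝ := sSup (spectrum ℝ M)

/-- `κ_X = d⁻¹ ∑ⱼ (E X₀ⱼ⁴)^(1/2)`. -/
def kappaX {d : ℕ} (ξ : Measure (EuclideanSpace ℝ (Fin d))) : ℝ :=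
  (d : ℝ)⁻¹ * ∑ j : Fin d, Real.sqrt (∫ x, x j ^ 4 ∂ξ)

/-- `σ_{X,max}`, the square root of `maxⱼ Var X₀ⱼ`. -/
def sigmaXMax {d : ℕ} (ξ : Measure (EuclideanSpace ℝ (Fin d))) : ℝ :=
  Real.sqrt (⨆ j : Fin d, Var[fun x => x j; ξ])

/-- `σ_{X,min}`, the square root of `minⱼ Var X₀ⱼ`. -/
def sigmaXMin {d : ℕ} (ξ : Measure (EuclideanSpace ℝ (Fin d))) : ℝ :=
  Real.sqrt (⨅ j : Fin d, Var[fun x => x j; ξ])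

/-- `γ_{X,max} = maxⱼ E |X₀ⱼ|³`. -/
def gammaXMax {d : ℕ} (ξ : Measure (EuclideanSpace ℝ (Fin d))) : ℝ :=
  ⨆ j : Fin d, ∫ x, |x j| ^ 3 ∂ξ

/-- A bounded real sequence. -/
def BoundedSeq (u : ℕ → ℝ) : Prop := ∃ C : ℝ, ∀ n, |u n| ≤ C

/-- A real sequence that is (eventually) bounded away from zero, from above. -/
def AwayFromZero (u : ℕ → ℝ) : Prop := ∃ c : ℝ, 0 < c ∧ ∀ᶠ n in atTop, c ≤ u n

/-- `u n ≪ min_{i ≤ s₁} |μᵢ|`: the sequence `u` is of smaller order than the absolute values of the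
first `s₁` entries of `μ`, uniformly in these entries (indices start at `0`). -/
def MuchLessThanLarge (u : ℕ → ℝ) (s₁ : ℕ → ℕ) (μ : (n : ℕ) → Fin n → ℝ) : Prop :=
  ∀ c : ℝ, 0 < c → ∀ᶠ n in atTop, ∀ i : Fin n, i.val < s₁ n → u n ≤ c * |μ n i|

/-- The responses `Yᵢ = μᵢ + Xᵢᵀ β + εᵢ`. -/
def response {n d : ℕ} (μ : Fin n → ℝ) (X : Fin n → EuclideanSpace ℝ (Fin d))
    (β : EuclideanSpace ℝ (Fin d)) (ε : Fin n → ℝ) (i : Fin n) : ℝ :=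
  μ i + inner ℝ (X i) β + ε i

/-- The least-squares loss with soft penalty
`L(μ, β) = ‖Y - μ - X β‖² + ∑ᵢ 2 λ |μᵢ|`. -/
def penalizedLoss {n d : ℕ} (lam : ℝ) (X : Fin n → EuclideanSpace ℝ (Fin d)) (Y : Fin n → ℝ)
    (p : (Fin n → ℝ) × EuclideanSpace ℝ (Fin d)) : ℝ :=
  ∑ i, (Y i - p.1 i - inner ℝ (X i) p.2) ^ 2 + ∑ i, 2 * lam * |p.1 i|

/-- The set of indices at which a vector vanishes. -/
def zeroIndices {n : ℕ} (m : Fin n → ℝ) : Finset (Fin n) :=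
  Finset.univ.filter fun i => m i = 0

/-- The rows of the design matrix with index in `I`. -/
def designOn {n d : ℕ} (X : Fin n → EuclideanSpace ℝ (Fin d)) (I : Finset (Fin n)) :
    Matrix I (Fin d) ℝ :=
  Matrix.of fun i j => X i.1 j

/-- The least-squares estimator `(X_Iᵀ X_I)⁻¹ X_Iᵀ Y_I` from the observations with index in `I`. -/
def leastSquaresOn {n d : ℕ} (X : Fin n → EuclideanSpace ℝ (Fin d)) (Y : Fin n → ℝ)
    (I : Finset (Fin n)) : EuclideanSpace ℝ (Fin d) :=
  WithLp.toLp 2 (((designOn X I)ᵀ * designOn X I)⁻¹ *ᵥ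
    ((designOn X I)ᵀ *ᵥ fun i : I => Y i.1))

/-- The two-step estimator: least squares on the observations whose estimated incidental
parameter `mᵢ` is zero. -/
def twoStep {n d : ℕ} (X : Fin n → EuclideanSpace ℝ (Fin d)) (Y : Fin n → ℝ)
    (m : Fin n → ℝ) : EuclideanSpace ℝ (Fin d) :=
  leastSquaresOn X Y (zeroIndices m)

end

end IncidentalRegression

namespace IncidentalRegression

/-- The pairs formed from two independent families of independent variables are independent. -/
theorem iIndepFun_pair {Ω ι E F : Type*} [Fintype ι] [MeasurableSpace Ω] [MeasurableSpace E]
    [MeasurableSpace F] {P : Measure Ω} [IsProbabilityMeasure P] {X : ι → Ω → E} {Y : ι → Ω → F}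
    (hX : ∀ i, AEMeasurable (X i) P) (hY : ∀ i, AEMeasurable (Y i) P)
    (hXi : iIndepFun X P) (hYi : iIndepFun Y P)
    (hXY : IndepFun (fun ω i => X i ω) (fun ω i => Y i ω) P) :
    iIndepFun (fun i ω => (X i ω, Y i ω)) P := by
  have hpX : ∀ i, IsProbabilityMeasure (P.map (X i)) :=
    fun i => Measure.isProbabilityMeasure_map (hX i)
  have hpY : ∀ i, IsProbabilityMeasure (P.map (Y i)) :=
    fun i => Measure.isProbabilityMeasure_map (hY i)
  have hXv : AEMeasurable (fun ω i => X i ω) P := aemeasurable_pi_lambda _ hX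
  have hYv : AEMeasurable (fun ω i => Y i ω) P := aemeasurable_pi_lambda _ hY
  have hpair : ∀ i, P.map (fun ω => (X i ω, Y i ω)) = (P.map (X i)).prod (P.map (Y i)) := by
    intro i
    refine (indepFun_iff_map_prod_eq_prod_map_map (hX i) (hY i)).1 ?_
    exact hXY.comp (φ := fun x : ι → E => x i) (ψ := fun y : ι → F => y i)
      (measurable_pi_apply i) (measurable_pi_apply i)
  have hmp : MeasurePreserving (MeasurableEquiv.arrowProdEquivProdArrow E F ι).symm
      ((Measure.pi fun i => P.map (X i)).prod (Measure.pi fun i => P.map (Y i)))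
      (Measure.pi fun i => (P.map (X i)).prod (P.map (Y i))) :=
    (measurePreserving_arrowProdEquivProdArrow E F ι _ _).symm
  rw [iIndepFun_iff_map_fun_eq_pi_map (fun i => (hX i).prodMk (hY i))]
  simp_rw [hpair]
  rw [← hmp.map_eq, ← (iIndepFun_iff_map_fun_eq_pi_map hX).1 hXi,
    ← (iIndepFun_iff_map_fun_eq_pi_map hY).1 hYi,
    ← (indepFun_iff_map_prod_eq_prod_map_map hXv hYv).1 hXY,
    AEMeasurable.map_map_of_aemeasurable (MeasurableEquiv.measurable _).aemeasurable
      (hXv.prodMk hYv)]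
  rfl

theorem hasLaw_pair {Ω E F : Type*} [MeasurableSpace Ω] [MeasurableSpace E]
    [MeasurableSpace F] {P : Measure Ω} [IsProbabilityMeasure P] {X : Ω → E} {Y : Ω → F}
    {ξ : Measure E} {ν : Measure F} (hX : HasLaw X ξ P) (hY : HasLaw Y ν P)
    (hXY : IndepFun X Y P) : HasLaw (fun ω => (X ω, Y ω)) (ξ.prod ν) P where
  aemeasurable := hX.aemeasurable.prodMk hY.aemeasurable
  map_eq := by
    rw [(indepFun_iff_map_prod_eq_prod_map_map hX.aemeasurable hY.aemeasurable).1 hXY,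
      hX.map_eq, hY.map_eq]

theorem integral_law {Ω E G : Type*} [MeasurableSpace Ω] [MeasurableSpace E]
    [NormedAddCommGroup G] [NormedSpace ℝ G] {P : Measure Ω} {U : Ω → E} {ρ : Measure E}
    (hlaw : HasLaw U ρ P) {f : E → G} (hf : AEStronglyMeasurable f ρ) :
    ∫ ω, f (U ω) ∂P = ∫ x, f x ∂ρ :=
  hlaw.integral_comp hf

/-- Chebyshev's inequality for a vector of weighted sums of i.i.d. centred variables. -/
theorem measure_sum_sq_ge_le {Ω E J : Type*} [MeasurableSpace Ω] [MeasurableSpace E] [Fintype J]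
    {P : Measure Ω} [IsProbabilityMeasure P] {n : ℕ} {U : Fin n → Ω → E} {ρ : Measure E}
    (hind : iIndepFun U P) (hlaw : ∀ i, HasLaw (U i) ρ P) {f : J → E → ℝ}
    (hfm : ∀ j, Measurable (f j)) (hf : ∀ j, MemLp (f j) 2 ρ) (h0 : ∀ j, ∫ x, f j x ∂ρ = 0)
    {c : Fin n → ℝ} (hc : ∀ i, |c i| ≤ 1) (I : Finset (Fin n)) {M : ℝ} (hM : 0 < M) :
    P {ω | M ^ 2 ≤ ∑ j, (∑ i ∈ I, c i * f j (U i ω)) ^ 2} ≤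
      ENNReal.ofReal (n * (∑ j, ∫ x, f j x ^ 2 ∂ρ) / M ^ 2) := by
  have hL : ∀ j i, MemLp (fun ω => c i * f j (U i ω)) 2 P := by
    intro j i
    have := (hf j)
    rw [← (hlaw i).map_eq] at this
    exact ((memLp_map_measure_iff this.aestronglyMeasurable (hlaw i).aemeasurable).1
      this).const_mul _
  have hLs : ∀ j, MemLp (∑ i ∈ I, fun ω => c i * f j (U i ω)) 2 P := fun j =>
    memLp_finsetSum' _ fun i _ => hL j i
  have hmean : ∀ j i, ∫ ω, c i * f j (U i ω) ∂P = 0 := by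
    intro j i
    rw [integral_const_mul, integral_law (f := f j) (hlaw i) (hf j).aestronglyMeasurable, h0,
      mul_zero]
  have hsq : ∀ j, ∫ ω, (∑ i ∈ I, c i * f j (U i ω)) ^ 2 ∂P ≤ n * ∫ x, f j x ^ 2 ∂ρ := by
    intro j
    have hv := IndepFun.variance_sum (μ := P) (X := fun i ω => c i * f j (U i ω)) (s := I)
      (fun i _ => hL j i) (fun i _ k _ hik => (hind.indepFun hik).comp
        (φ := fun x => c i * f j x) (ψ := fun x => c k * f j x) ((hfm j).const_mul _)
        ((hfm j).const_mul _))
    rw [variance_eq_integral (hLs j).aemeasurable] at hv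
    have hz : ∫ ω, (∑ i ∈ I, fun ω => c i * f j (U i ω)) ω ∂P = 0 := by
      simp only [Finset.sum_apply]
      rw [integral_finsetSum _ fun i _ => (hL j i).integrable (by norm_num)]
      simp [hmean]
    rw [hz] at hv
    simp only [Finset.sum_apply, sub_zero] at hv
    rw [hv]
    have hb : ∀ i ∈ I, Var[fun ω => c i * f j (U i ω); P] ≤ ∫ x, f j x ^ 2 ∂ρ := by
      intro i _
      refine (variance_le_expectation_sq (hL j i).aestronglyMeasurable).trans ?_
      simp only [Pi.pow_apply, mul_pow]
      rw [integral_const_mul, integral_law (f := fun x => f j x ^ 2) (hlaw i)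
        ((hfm j).pow_const 2).aestronglyMeasurable]
      have : c i ^ 2 ≤ 1 := by
        rw [← sq_abs]; exact pow_le_one₀ (abs_nonneg _) (hc i)
      exact mul_le_of_le_one_left (integral_nonneg fun x => sq_nonneg _) this
    refine (Finset.sum_le_card_nsmul _ _ _ hb).trans ?_
    rw [nsmul_eq_mul]
    refine mul_le_mul_of_nonneg_right ?_ (integral_nonneg fun x => sq_nonneg _)
    exact_mod_cast (Finset.card_le_univ I).trans (by simp)
  have hint : ∀ j, Integrable (fun ω => (∑ i ∈ I, c i * f j (U i ω)) ^ 2) P := by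
    intro j
    simpa using (hLs j).integrable_sq
  have hmk := mul_meas_ge_le_integral_of_nonneg (μ := P)
    (f := fun ω => ∑ j, (∑ i ∈ I, c i * f j (U i ω)) ^ 2)
    (Eventually.of_forall fun ω => Finset.sum_nonneg fun j _ => sq_nonneg _)
    (integrable_finsetSum _ fun j _ => hint j) (M ^ 2)
  rw [integral_finsetSum _ fun j _ => hint j] at hmk
  rw [← ENNReal.ofReal_toReal (measure_ne_top P _)]
  refine ENNReal.ofReal_le_ofReal ?_
  rw [le_div_iff₀ (by positivity), mul_comm]
  refine hmk.trans ?_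
  rw [Finset.mul_sum]
  exact Finset.sum_le_sum fun j _ => hsq j

/-- Markov's inequality for the maximum of identically distributed variables. -/
theorem measure_exists_lt_le {Ω E : Type*} [MeasurableSpace Ω] [MeasurableSpace E]
    {P : Measure Ω} [IsProbabilityMeasure P] {n : ℕ} {U : Fin n → Ω → E} {ρ : Measure E}
    (hlaw : ∀ i, HasLaw (U i) ρ P) {f : E → ℝ} (hf0 : ∀ x, 0 ≤ f x)
    (hf : Integrable f ρ) {M : ℝ} (hM : 0 < M) :
    P {ω | ∃ i, M < f (U i ω)} ≤ ENNReal.ofReal (n * (∫ x, f x ∂ρ) / M) := by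
  have h1 : ∀ i, P {ω | M < f (U i ω)} ≤ ENNReal.ofReal ((∫ x, f x ∂ρ) / M) := by
    intro i
    have hfi : Integrable (fun ω => f (U i ω)) P := by
      rw [← (hlaw i).map_eq] at hf
      exact (integrable_map_measure hf.aestronglyMeasurable (hlaw i).aemeasurable).1 hf
    have hmk := mul_meas_ge_le_integral_of_nonneg (μ := P) (f := fun ω => f (U i ω))
      (Eventually.of_forall fun ω => hf0 _) hfi M
    rw [integral_law (f := f) (hlaw i) hf.aestronglyMeasurable] at hmk
    refine (measure_mono (t := {ω | M ≤ f (U i ω)}) fun ω (hω : M < f (U i ω)) =>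
      show M ≤ f (U i ω) from hω.le).trans ?_
    rw [← ENNReal.ofReal_toReal (measure_ne_top P _)]
    refine ENNReal.ofReal_le_ofReal ?_
    rwa [le_div_iff₀ hM, mul_comm]
  have : {ω | ∃ i, M < f (U i ω)} = ⋃ i, {ω | M < f (U i ω)} := by ext; simp
  rw [this]
  refine (measure_iUnion_le _).trans ?_
  rw [tsum_fintype]
  refine (Finset.sum_le_sum fun i _ => h1 i).trans ?_
  rw [Finset.sum_const, Finset.card_univ, Fintype.card_fin, mul_div_assoc,
    ENNReal.ofReal_mul (by positivity), ENNReal.ofReal_natCast, nsmul_eq_mul]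

theorem norm_exp_I_sub_taylor_le (x : ℝ) :
    ‖Complex.exp (x * Complex.I) - 1 - x * Complex.I + x ^ 2 / 2‖ ≤ 4 * (x ^ 2 * min 1 |x|) := by
  rcases le_total |x| 1 with hx | hx
  · have h := Complex.exp_bound (x := x * Complex.I) (by simpa using hx) (n := 3) (by norm_num)
    rw [min_eq_right hx]
    simp only [Finset.sum_range_succ, Finset.range_zero, Finset.sum_empty, Nat.factorial,
      norm_mul, Complex.norm_I, Complex.norm_real, Real.norm_eq_abs, mul_one] at h
    have e : Complex.exp (x * Complex.I) - 1 - x * Complex.I + x ^ 2 / 2 =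
        Complex.exp (↑x * Complex.I) - (0 + (↑x * Complex.I) ^ 0 / ((1 : ℕ) : ℂ) +
          (↑x * Complex.I) ^ 1 / (((0 + 1) * 1 : ℕ) : ℂ) +
          (↑x * Complex.I) ^ 2 / (((1 + 1) * ((0 + 1) * 1) : ℕ) : ℂ)) := by
      rw [mul_pow _ _ 2, Complex.I_sq]
      push_cast
      ring
    rw [e]
    refine (h.trans ?_)
    have : (0 : ℝ) ≤ |x| ^ 3 := by positivity
    norm_num
    have e3 : |x| ^ 2 * |x| = |x| ^ 3 := by ring
    rw [← sq_abs x, e3]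
    linarith
  · rw [min_eq_left hx, mul_one]
    have h1 : ‖Complex.exp (x * Complex.I)‖ = 1 := Complex.norm_exp_ofReal_mul_I x
    have h2 : ‖(x : ℂ) * Complex.I‖ = |x| := by simp
    have h3 : ‖(x : ℂ) ^ 2 / 2‖ = |x| ^ 2 / 2 := by simp
    calc _ ≤ ‖Complex.exp (x * Complex.I)‖ + ‖(1 : ℂ)‖ + ‖(x : ℂ) * Complex.I‖
          + ‖(x : ℂ) ^ 2 / 2‖ :=
          (norm_add_le _ _).trans (add_le_add_left ((norm_sub_le _ _).trans
            (add_le_add_left (norm_sub_le _ _) _)) _)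
      _ ≤ 4 * x ^ 2 := by
          rw [h1, h2, h3, norm_one, ← sq_abs x]
          nlinarith

theorem norm_pow_sub_pow_le {z w : ℂ} (hz : ‖z‖ ≤ 1) (hw : ‖w‖ ≤ 1) (m : ℕ) :
    ‖z ^ m - w ^ m‖ ≤ m * ‖z - w‖ := by
  induction m with
  | zero => simp
  | succ m ih =>
    have e : z ^ (m + 1) - w ^ (m + 1) = (z ^ m - w ^ m) * z + w ^ m * (z - w) := by ring
    rw [e]
    have h2 : ‖w ^ m‖ ≤ 1 := by rw [norm_pow]; exact pow_le_one₀ (norm_nonneg _) hw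
    calc _ ≤ ‖z ^ m - w ^ m‖ * ‖z‖ + ‖w ^ m‖ * ‖z - w‖ := by
          refine (norm_add_le _ _).trans ?_
          rw [norm_mul, norm_mul]
      _ ≤ (m * ‖z - w‖) * 1 + 1 * ‖z - w‖ := by gcongr
      _ = _ := by push_cast; ring

theorem integral_exp_sum_eq_pow {Ω E : Type*} [MeasurableSpace Ω] [MeasurableSpace E]
    {P : Measure Ω} [IsProbabilityMeasure P] {n : ℕ} {U : Fin n → Ω → E} {ρ : Measure E}
    (hind : iIndepFun U P) (hlaw : ∀ i, HasLaw (U i) ρ P) {g : E → ℝ} (hg : Measurable g)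
    (I : Finset (Fin n)) :
    ∫ ω, Complex.exp (((∑ i ∈ I, g (U i ω) : ℝ) : ℂ) * Complex.I) ∂P =
      (∫ x, Complex.exp ((g x : ℂ) * Complex.I) ∂ρ) ^ I.card := by
  have hm : ∀ i, AEMeasurable (fun ω => g (U i ω)) P :=
    fun i => hg.comp_aemeasurable (hlaw i).aemeasurable
  have h := iIndepFun.charFun_map_fun_finsetSum_eq_prod (P := P) (s := I)
    (X := fun i ω => g (U i ω)) (fun i _ => hm i)
    ((hind.comp (fun _ => g) fun _ => hg).restrict I)
  have h1 := congrFun h 1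
  rw [Finset.prod_apply] at h1
  have hc : ∀ i, charFun (P.map fun ω => g (U i ω)) 1 =
      ∫ x, Complex.exp ((g x : ℂ) * Complex.I) ∂ρ := by
    intro i
    rw [charFun_apply_real, integral_map (hm i) (by fun_prop),
      ← integral_law (f := fun x => Complex.exp ((g x : ℂ) * Complex.I)) (hlaw i)
        (by fun_prop)]
    simp
  simp only [hc, Finset.prod_const] at h1
  rw [← h1, charFun_apply_real, integral_map (Finset.aemeasurable_fun_sum _ fun i _ => hm i)
    (by fun_prop)]
  simp

theorem norm_integral_exp_mul_sub_le {E : Type*} [MeasurableSpace E] {ξ : Measure E}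
    [IsProbabilityMeasure ξ] {ν : Measure ℝ} [IsProbabilityMeasure ν] {w : E → ℝ}
    (hw : Measurable w) (hw2 : MemLp w 2 ξ) (hw3 : Integrable (fun x => |w x| ^ 3) ξ)
    (hν : MemLp id 2 ν) (hν0 : ∫ x, x ∂ν = 0) {τ K : ℝ} (hτ : 0 ≤ τ) (hK : 0 ≤ K) :
    ‖∫ z : E × ℝ, Complex.exp (((τ * (w z.1 * z.2) : ℝ) : ℂ) * Complex.I) ∂(ξ.prod ν) -
        ((1 - τ ^ 2 * ((∫ x, w x ^ 2 ∂ξ) * ∫ y, y ^ 2 ∂ν) / 2 : ℝ) : ℂ)‖ ≤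
      4 * (τ ^ 2 * ((∫ x, w x ^ 2 ∂ξ) * (∫ y in {y | K < |y|}, y ^ 2 ∂ν) +
        K * τ * ((∫ x, |w x| ^ 3 ∂ξ) * ∫ y, y ^ 2 ∂ν))) := by
  have hν2 : Integrable (fun y : ℝ => y ^ 2) ν := by simpa using hν.integrable_sq
  have hν1 : Integrable (fun y : ℝ => y) ν := hν.integrable (by norm_num)
  have hKs : MeasurableSet {y : ℝ | K < |y|} := measurableSet_lt measurable_const (by fun_prop)
  have hνK : Integrable ({y : ℝ | K < |y|}.indicator fun y => y ^ 2) ν := hν2.indicator hKs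
  have hw1 : Integrable w ξ := hw2.integrable (by norm_num)
  have hwsq : Integrable (fun x => w x ^ 2) ξ := hw2.integrable_sq
  set g : E × ℝ → ℝ := fun z => τ * (w z.1 * z.2) with hg
  have hgm : Measurable g := by fun_prop
  have ig : Integrable g (ξ.prod ν) := (hw1.mul_prod hν1).const_mul τ
  have ig2 : Integrable (fun z => g z ^ 2) (ξ.prod ν) := by
    refine ((hwsq.mul_prod hν2).const_mul (τ ^ 2)).congr (Eventually.of_forall fun z => ?_)
    simp only [hg]; ring
  have ie : Integrable (fun z => Complex.exp ((g z : ℂ) * Complex.I)) (ξ.prod ν) := by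
    refine Integrable.of_bound (C := 1) (by fun_prop) (Eventually.of_forall fun z => ?_)
    exact (Complex.norm_exp_ofReal_mul_I _).le
  have Eg : ∫ z, g z ∂(ξ.prod ν) = 0 := by
    simp only [hg]
    rw [integral_const_mul, integral_prod_mul (fun x => w x) (fun y : ℝ => y), hν0]; simp
  have Eg2 : ∫ z, g z ^ 2 ∂(ξ.prod ν) = τ ^ 2 * ((∫ x, w x ^ 2 ∂ξ) * ∫ y, y ^ 2 ∂ν) := by
    rw [← integral_prod_mul (fun x => w x ^ 2) (fun y : ℝ => y ^ 2), ← integral_const_mul]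
    refine integral_congr_ae (Eventually.of_forall fun z => ?_)
    simp only [hg]; ring
  have hbI : Integrable (fun z : E × ℝ => 4 * (τ ^ 2 * (w z.1 ^ 2 *
      ({y : ℝ | K < |y|}.indicator (fun y => y ^ 2) z.2) + K * τ * (|w z.1| ^ 3 * z.2 ^ 2))))
      (ξ.prod ν) :=
    (((hwsq.mul_prod hνK).add ((hw3.mul_prod hν2).const_mul _)).const_mul _).const_mul _
  have key : ∫ z, Complex.exp ((g z : ℂ) * Complex.I) ∂(ξ.prod ν) -
        ((1 - τ ^ 2 * ((∫ x, w x ^ 2 ∂ξ) * ∫ y, y ^ 2 ∂ν) / 2 : ℝ) : ℂ) =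
      ∫ z, (Complex.exp ((g z : ℂ) * Complex.I) - 1 - (g z : ℂ) * Complex.I +
        (g z : ℂ) ^ 2 / 2) ∂(ξ.prod ν) := by
    have ig2c : Integrable (fun z => (g z : ℂ) ^ 2 / 2) (ξ.prod ν) := by
      have := (ig2.ofReal (𝕜 := ℂ)).div_const 2
      simpa using this
    have igc : Integrable (fun z => (g z : ℂ) * Complex.I) (ξ.prod ν) :=
      (ig.ofReal (𝕜 := ℂ)).mul_const _
    have e1 : ∫ z, (g z : ℂ) * Complex.I ∂(ξ.prod ν) = 0 := by
      rw [integral_mul_const, integral_complex_ofReal, Eg]; simp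
    have e2 : ∫ z, (g z : ℂ) ^ 2 / 2 ∂(ξ.prod ν) =
        ((τ ^ 2 * ((∫ x, w x ^ 2 ∂ξ) * ∫ y, y ^ 2 ∂ν) / 2 : ℝ) : ℂ) := by
      rw [← Eg2, ← integral_div, ← integral_complex_ofReal]
      simp
    have i1 : Integrable (fun z => Complex.exp ((g z : ℂ) * Complex.I) - 1) (ξ.prod ν) :=
      ie.sub (integrable_const _)
    have i2 : Integrable (fun z => Complex.exp ((g z : ℂ) * Complex.I) - 1 -
      (g z : ℂ) * Complex.I) (ξ.prod ν) := i1.sub igc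
    rw [integral_add i2 ig2c, integral_sub i1 igc, integral_sub ie (integrable_const _), e1, e2]
    simp
    ring
  rw [key]
  refine (norm_integral_le_integral_norm _).trans ?_
  have hle : ∀ z : E × ℝ, ‖Complex.exp ((g z : ℂ) * Complex.I) - 1 - (g z : ℂ) * Complex.I +
        (g z : ℂ) ^ 2 / 2‖ ≤ 4 * (τ ^ 2 * (w z.1 ^ 2 *
      ({y : ℝ | K < |y|}.indicator (fun y => y ^ 2) z.2) + K * τ * (|w z.1| ^ 3 * z.2 ^ 2))) := by
    intro z
    refine (norm_exp_I_sub_taylor_le (g z)).trans ?_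
    have eg : g z ^ 2 = τ ^ 2 * (w z.1 ^ 2 * z.2 ^ 2) := by simp only [hg]; ring
    rw [eg, mul_assoc (τ ^ 2)]
    refine mul_le_mul_of_nonneg_left (mul_le_mul_of_nonneg_left ?_ (sq_nonneg _)) (by norm_num)
    by_cases hz : K < |z.2|
    · rw [Set.indicator_of_mem (by exact hz)]
      have : 0 ≤ K * τ * (|w z.1| ^ 3 * z.2 ^ 2) := by positivity
      have h2 : w z.1 ^ 2 * z.2 ^ 2 * min 1 |g z| ≤ w z.1 ^ 2 * z.2 ^ 2 * 1 :=
        mul_le_mul_of_nonneg_left (min_le_left _ _) (by positivity)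
      linarith
    · rw [Set.indicator_of_notMem (by exact hz)]
      push Not at hz
      have h3 : min 1 |g z| ≤ τ * (|w z.1| * K) := by
        refine (min_le_right _ _).trans ?_
        simp only [hg]
        rw [abs_mul, abs_mul, abs_of_nonneg hτ]
        gcongr
      have h2 : w z.1 ^ 2 * z.2 ^ 2 * min 1 |g z| ≤ w z.1 ^ 2 * z.2 ^ 2 * (τ * (|w z.1| * K)) :=
        mul_le_mul_of_nonneg_left h3 (by positivity)
      refine h2.trans (le_of_eq ?_)
      rw [← sq_abs (w z.1)]
      ring
  refine (integral_mono_of_nonneg (Eventually.of_forall fun z => norm_nonneg _) hbI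
    (Eventually.of_forall hle)).trans (le_of_eq ?_)
  rw [integral_const_mul, integral_const_mul, integral_add (hwsq.mul_prod hνK)
    ((hw3.mul_prod hν2).const_mul _), integral_const_mul,
    integral_prod_mul (fun x => w x ^ 2) ({y : ℝ | K < |y|}.indicator fun y : ℝ => y ^ 2),
    integral_prod_mul (fun x => |w x| ^ 3) (fun y : ℝ => y ^ 2), integral_indicator hKs]

theorem tendsto_setIntegral_abs_gt {ν : Measure ℝ} (hν2 : Integrable (fun y : ℝ => y ^ 2) ν) :
    Tendsto (fun K : ℕ => ∫ y in {y : ℝ | (K : ℝ) < |y|}, y ^ 2 ∂ν) atTop (𝓝 0) := by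
  have h := tendsto_setIntegral_of_antitone (μ := ν) (f := fun y : ℝ => y ^ 2)
    (s := fun K : ℕ => {y : ℝ | (K : ℝ) < |y|})
    (fun K => measurableSet_lt measurable_const (by fun_prop))
    (fun a b hab y (hy : (b : ℝ) < |y|) =>
      show (a : ℝ) < |y| from lt_of_le_of_lt (by exact_mod_cast hab) hy)
    ⟨0, hν2.integrableOn⟩
  have he : ⋂ K : ℕ, {y : ℝ | (K : ℝ) < |y|} = ∅ := by
    ext y
    simp only [Set.mem_iInter, Set.mem_ofPred_eq, Set.mem_empty_iff_false, iff_false, not_forall,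
      not_lt]
    exact exists_nat_ge |y|
  simpa [he] using h

/-- Convergence of characteristic functions in the central limit theorem for triangular arrays of
products `w(x) y` of independent factors, row-wise i.i.d. -/
theorem tendsto_integral_exp_pow {E : ℕ → Type*} [∀ n, MeasurableSpace (E n)]
    {ξ : (n : ℕ) → Measure (E n)} [∀ n, IsProbabilityMeasure (ξ n)] {ν : Measure ℝ}
    [IsProbabilityMeasure ν] {w : (n : ℕ) → E n → ℝ} (hw : ∀ n, Measurable (w n))
    (hw2 : ∀ n, MemLp (w n) 2 (ξ n)) (hw3 : ∀ n, Integrable (fun x => |w n x| ^ 3) (ξ n))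
    (hν : MemLp id 2 ν) (hν0 : ∫ x, x ∂ν = 0) {τ : ℕ → ℝ} (hτ : ∀ n, 0 ≤ τ n) {m : ℕ → ℕ}
    (hτ0 : Tendsto τ atTop (𝓝 0)) (hm : Tendsto (fun n => m n * τ n ^ 2) atTop (𝓝 1)) {v : ℝ}
    (hv : Tendsto (fun n => ∫ x, w n x ^ 2 ∂(ξ n)) atTop (𝓝 v))
    (h3 : Tendsto (fun n => τ n * ∫ x, |w n x| ^ 3 ∂(ξ n)) atTop (𝓝 0)) :
    Tendsto (fun n => (∫ z : E n × ℝ, Complex.exp (((τ n * (w n z.1 * z.2) : ℝ) : ℂ) *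
      Complex.I) ∂((ξ n).prod ν)) ^ m n) atTop
      (𝓝 (Complex.exp ((-((∫ y, y ^ 2 ∂ν) * v) / 2 : ℝ) : ℂ))) := by
  have hν2 : Integrable (fun y : ℝ => y ^ 2) ν := by simpa using hν.integrable_sq
  set S := ∫ y, y ^ 2 ∂ν with hS
  have hS0 : 0 ≤ S := integral_nonneg fun y => sq_nonneg _
  set V : ℕ → ℝ := fun n => ∫ x, w n x ^ 2 ∂(ξ n) with hV
  have hV0 : ∀ n, 0 ≤ V n := fun n => integral_nonneg fun x => sq_nonneg _
  set φ : ℕ → ℂ := fun n => ∫ z : E n × ℝ, Complex.exp (((τ n * (w n z.1 * z.2) : ℝ) : ℂ) *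
      Complex.I) ∂((ξ n).prod ν) with hφ
  set a : ℕ → ℝ := fun n => τ n ^ 2 * (V n * S) / 2 with ha
  have ha0 : ∀ n, 0 ≤ a n := fun n => by
    have := hV0 n
    simp only [ha]; positivity
  have hφ1 : ∀ n, ‖φ n‖ ≤ 1 := by
    intro n
    refine (norm_integral_le_integral_norm _).trans ?_
    simp only [Complex.norm_exp_ofReal_mul_I]
    simp
  have hma : Tendsto (fun n => m n * a n) atTop (𝓝 (S * v / 2)) := by
    have := (hm.mul (hv.mul_const S)).div_const 2
    refine (this.congr fun n => ?_).congr' EventuallyEq.rfl |>.trans (by ring_nf; rfl)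
    simp only [ha]; ring
  have haz : Tendsto a atTop (𝓝 0) := by
    have := ((hτ0.pow 2).mul (hv.mul_const S)).div_const 2
    simpa using this
  have hexp : Tendsto (fun n => (Complex.exp (-(a n : ℝ) : ℝ)) ^ m n) atTop
      (𝓝 (Complex.exp ((-(S * v) / 2 : ℝ) : ℂ))) := by
    have h1 : Tendsto (fun n => Complex.exp ((-(m n * a n) : ℝ) : ℂ)) atTop
        (𝓝 (Complex.exp ((-(S * v / 2) : ℝ) : ℂ))) :=
      (Complex.continuous_exp.comp Complex.continuous_ofReal).continuousAt.tendsto.comp hma.neg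
    rw [neg_div]
    refine h1.congr fun n => ?_
    rw [← Complex.exp_nat_mul]
    push_cast
    ring_nf
  have hdiff : Tendsto (fun n => m n * ‖φ n - Complex.exp (-(a n : ℝ) : ℝ)‖) atTop (𝓝 0) := by
    rw [Metric.tendsto_atTop]
    intro δ hδ
    have hη := tendsto_setIntegral_abs_gt hν2
    obtain ⟨K, hK⟩ : ∃ K : ℕ, 4 * (v * ∫ y in {y : ℝ | (K : ℝ) < |y|}, y ^ 2 ∂ν) < δ / 2 := by
      have h := ((hη.const_mul v).const_mul 4)
      simp only [mul_zero] at h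
      exact (h.eventually (gt_mem_nhds (half_pos hδ))).exists
    set η := ∫ y in {y : ℝ | (K : ℝ) < |y|}, y ^ 2 ∂ν
    have hlim : Tendsto (fun n => 4 * ((m n * τ n ^ 2) * (V n * η + K *
        (τ n * ∫ x, |w n x| ^ 3 ∂(ξ n)) * S)) + (m n * a n) * a n) atTop
        (𝓝 (4 * (1 * (v * η + K * 0 * S)) + (S * v / 2) * 0)) :=
      ((hm.mul ((hv.mul_const η).add ((h3.const_mul _).mul_const S))).const_mul 4).add
        (hma.mul haz)
    have hlt : 4 * (1 * (v * η + K * 0 * S)) + (S * v / 2) * 0 < δ := by linarith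
    have hev := (hlim.eventually (gt_mem_nhds hlt)).and (haz.eventually (gt_mem_nhds one_pos))
    obtain ⟨N, hN⟩ := eventually_atTop.1 hev
    refine ⟨N, fun n hn => ?_⟩
    obtain ⟨h1, h2⟩ := hN n hn
    rw [Real.dist_0_eq_abs, abs_of_nonneg (by positivity)]
    refine lt_of_le_of_lt ?_ h1
    have hb1 := norm_integral_exp_mul_sub_le (hw n) (hw2 n) (hw3 n) hν hν0 (hτ n)
      (K := (K : ℝ)) (by positivity)
    have hb2 : ‖((1 - a n : ℝ) : ℂ) - Complex.exp (-(a n : ℝ) : ℝ)‖ ≤ a n ^ 2 := by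
      have h := Real.norm_exp_sub_one_sub_id_le (x := -a n) (by
        rw [norm_neg, Real.norm_eq_abs, abs_of_nonneg (ha0 n)]; exact h2.le)
      rw [← Complex.ofReal_exp, ← Complex.ofReal_sub, Complex.norm_real, norm_sub_rev]
      rw [norm_neg, Real.norm_eq_abs (a n), sq_abs] at h
      refine le_trans (le_of_eq ?_) h
      congr 1
      ring
    have htri : ‖φ n - Complex.exp (-(a n : ℝ) : ℝ)‖ ≤
        ‖φ n - ((1 - a n : ℝ) : ℂ)‖ + ‖((1 - a n : ℝ) : ℂ) - Complex.exp (-(a n : ℝ) : ℝ)‖ :=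
      norm_sub_le_norm_sub_add_norm_sub _ _ _
    calc _ ≤ (m n : ℝ) * (4 * (τ n ^ 2 * (V n * η + K * τ n *
          ((∫ x, |w n x| ^ 3 ∂(ξ n)) * S))) + a n ^ 2) := by
          refine mul_le_mul_of_nonneg_left ?_ (Nat.cast_nonneg _)
          exact htri.trans (add_le_add hb1 hb2)
      _ = _ := by ring
  have hsub : Tendsto (fun n => φ n ^ m n - (Complex.exp (-(a n : ℝ) : ℝ)) ^ m n) atTop
      (𝓝 0) := by
    refine squeeze_zero_norm (fun n => norm_pow_sub_pow_le (hφ1 n) ?_ (m n)) hdiff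
    rw [← Complex.ofReal_exp, Complex.norm_real, Real.norm_eq_abs, abs_of_pos (Real.exp_pos _)]
    exact Real.exp_le_one_iff.2 (by have := ha0 n; linarith)
  have hfin := hsub.add hexp
  rw [zero_add] at hfin
  exact hfin.congr fun n => sub_add_cancel _ _

/-- A sign of a real number, with value `1` at `0`. -/
noncomputable def sgn (t : ℝ) : ℝ := if 0 ≤ t then 1 else -1

theorem abs_sgn (t : ℝ) : |sgn t| = 1 := by
  unfold sgn; split_ifs <;> simp

theorem sgn_sq (t : ℝ) : sgn t ^ 2 = 1 := by
  rw [← sq_abs, abs_sgn, one_pow]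

theorem sgn_mul_self (t : ℝ) : sgn t * t = |t| := by
  unfold sgn
  split_ifs with h
  · rw [abs_of_nonneg h, one_mul]
  · rw [abs_of_neg (not_le.1 h)]; ring

/-- The contribution of one observation with residual `r` to the penalized loss. -/
noncomputable def lossTerm (l r m : ℝ) : ℝ := (r - m) ^ 2 + 2 * l * |m|

theorem sq_add_le_lossTerm (l r m : ℝ) :
    r ^ 2 + (m ^ 2 + 2 * |m| * (l - |r|)) ≤ lossTerm l r m := by
  have : r * m ≤ |r| * |m| := by rw [← abs_mul]; exact le_abs_self _
  unfold lossTerm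
  nlinarith

theorem linear_le_lossTerm {l : ℝ} (hl : 0 ≤ l) (r m t : ℝ) :
    2 * l * (sgn t * r) - l ^ 2 ≤ lossTerm l r m := by
  have h1 : sgn t * m ≤ |m| := by
    calc sgn t * m ≤ |sgn t * m| := le_abs_self _
      _ = |m| := by rw [abs_mul, abs_sgn, one_mul]
  have h2 := sgn_sq t
  have h3 : 0 ≤ (r - m - l * sgn t) ^ 2 := sq_nonneg _
  have h4 : l * (sgn t * m) ≤ l * |m| := mul_le_mul_of_nonneg_left h1 hl
  unfold lossTerm
  nlinarith

theorem lossTerm_sub_eq {l r t : ℝ} (h : l ≤ sgn t * r) :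
    lossTerm l r (r - l * sgn t) = 2 * l * (sgn t * r) - l ^ 2 := by
  have h2 := sgn_sq t
  have h1 : |r - l * sgn t| = sgn t * r - l := by
    calc |r - l * sgn t| = |sgn t| * |r - l * sgn t| := by rw [abs_sgn, one_mul]
      _ = |sgn t * r - l| := by
          rw [← abs_mul]; congr 1; linear_combination (-l) * h2
      _ = _ := abs_of_nonneg (by linarith)
  unfold lossTerm
  rw [h1]
  linear_combination l ^ 2 * h2

theorem lossTerm_convex {l : ℝ} (hl : 0 ≤ l) {t : ℝ} (h0 : 0 ≤ t) (h1 : t ≤ 1)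
    (r₀ r₁ m₀ m₁ : ℝ) :
    lossTerm l ((1 - t) * r₀ + t * r₁) ((1 - t) * m₀ + t * m₁) ≤
      (1 - t) * lossTerm l r₀ m₀ + t * lossTerm l r₁ m₁ := by
  have hs : 0 ≤ 1 - t := by linarith
  have ha : |(1 - t) * m₀ + t * m₁| ≤ (1 - t) * |m₀| + t * |m₁| := by
    refine (abs_add_le _ _).trans ?_
    rw [abs_mul, abs_mul, abs_of_nonneg hs, abs_of_nonneg h0]
  have hb := mul_le_mul_of_nonneg_left ha hl
  have hq : 0 ≤ t * (1 - t) * ((r₀ - m₀) - (r₁ - m₁)) ^ 2 := by positivity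
  unfold lossTerm
  nlinarith

theorem penalizedLoss_add {n d : ℕ} (l : ℝ) (x : Fin n → EuclideanSpace ℝ (Fin d))
    (mu e : Fin n → ℝ) (β u : EuclideanSpace ℝ (Fin d)) (m : Fin n → ℝ) :
    penalizedLoss l x (response mu x β e) (m, β + u) =
      ∑ i, lossTerm l (mu i + e i - inner ℝ (x i) u) (m i) := by
  unfold penalizedLoss response lossTerm
  rw [← Finset.sum_add_distrib]
  refine Finset.sum_congr rfl fun i _ => ?_
  simp only [inner_add_right]
  ring

/-- The set of indices of the observations without a large incidental parameter. -/
def smallIdx (n s : ℕ) : Finset (Fin n) := Finset.univ.filter fun i => s ≤ i.val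

/-- The set of indices of the observations with a large incidental parameter. -/
def largeIdx (n s : ℕ) : Finset (Fin n) := Finset.univ.filter fun i => i.val < s

theorem sum_ite_lt {n : ℕ} (s : ℕ) (f g : Fin n → ℝ) :
    ∑ i : Fin n, (if i.val < s then f i else g i) =
      ∑ i ∈ largeIdx n s, f i + ∑ i ∈ smallIdx n s, g i := by
  rw [Finset.sum_ite]
  simp only [largeIdx, smallIdx, not_lt]

/-- Localization of the minimizer of the penalized loss: its structural part is within distance
`R` of the true parameter. -/
theorem norm_le_of_isMinOn {n d s : ℕ} {x : Fin n → EuclideanSpace ℝ (Fin d)}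
    {mu e mh : Fin n → ℝ} {β u : EuclideanSpace ℝ (Fin d)} {l R b : ℝ} (hl : 0 ≤ l) (hR : 0 < R)
    (hlarge : ∀ i : Fin n, i.val < s → l ≤ sgn (mu i) * (mu i + e i))
    (hsmall : ∀ i : Fin n, s ≤ i.val → ∀ v : EuclideanSpace ℝ (Fin d), ‖v‖ ≤ R →
      |mu i + e i - inner ℝ (x i) v| ≤ l)
    (hcoer : ∀ v : EuclideanSpace ℝ (Fin d),
      b * ‖v‖ ^ 2 ≤ ∑ i ∈ smallIdx n s, inner ℝ (x i) v ^ 2)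
    (hscore : 2 * ‖∑ i ∈ smallIdx n s, (mu i + e i) • x i +
      l • ∑ i ∈ largeIdx n s, sgn (mu i) • x i‖ < b * R)
    (hmin : IsMinOn (penalizedLoss l x (response mu x β e)) Set.univ (mh, β + u)) :
    ‖u‖ ≤ R := by
  by_contra hu
  push Not at hu
  have hu0 : 0 < ‖u‖ := hR.trans hu
  set t := R / ‖u‖ with ht
  have ht0 : 0 ≤ t := by positivity
  have ht1 : t ≤ 1 := (div_le_one hu0).2 hu.le
  have hv : ‖t • u‖ = R := by
    rw [norm_smul, Real.norm_eq_abs, abs_of_nonneg ht0, ht, div_mul_cancel₀ _ hu0.ne']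
  set r₀ : Fin n → ℝ := fun i => mu i + e i with hr₀
  set Q : Fin n → ℝ → ℝ := fun i r =>
    if i.val < s then 2 * l * (sgn (mu i) * r) - l ^ 2 else r ^ 2 with hQ
  set m₀ : Fin n → ℝ := fun i => if i.val < s then r₀ i - l * sgn (mu i) else 0 with hm₀
  have hQ0 : ∀ i, lossTerm l (r₀ i) (m₀ i) = Q i (r₀ i) := by
    intro i
    simp only [hQ, hm₀]
    split_ifs with h
    · exact lossTerm_sub_eq (hlarge i h)
    · simp [lossTerm]
  have hlow : ∀ i m, Q i (r₀ i - inner ℝ (x i) (t • u)) ≤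
      lossTerm l (r₀ i - inner ℝ (x i) (t • u)) m := by
    intro i m
    simp only [hQ]
    split_ifs with h
    · exact linear_le_lossTerm hl _ _ _
    · have h1 := hsmall i (not_lt.1 h) (t • u) hv.le
      have h2 := sq_add_le_lossTerm l (r₀ i - inner ℝ (x i) (t • u)) m
      have : 0 ≤ m ^ 2 + 2 * |m| * (l - |r₀ i - inner ℝ (x i) (t • u)|) := by
        have : 0 ≤ l - |r₀ i - inner ℝ (x i) (t • u)| := by linarith
        positivity
      linarith
  have hmin0 : ∑ i, lossTerm l (r₀ i - inner ℝ (x i) u) (mh i) ≤ ∑ i, Q i (r₀ i) := by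
    have h := hmin (Set.mem_univ (m₀, β + 0))
    simp only [Set.mem_ofPred_eq, penalizedLoss_add, inner_zero_right, sub_zero] at h
    rwa [Finset.sum_congr rfl fun i _ => hQ0 i] at h
  have hle : ∑ i, Q i (r₀ i - inner ℝ (x i) (t • u)) ≤ ∑ i, Q i (r₀ i) := by
    calc ∑ i, Q i (r₀ i - inner ℝ (x i) (t • u))
        ≤ ∑ i, ((1 - t) * lossTerm l (r₀ i) (m₀ i) +
            t * lossTerm l (r₀ i - inner ℝ (x i) u) (mh i)) := by
          refine Finset.sum_le_sum fun i _ => ?_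
          refine (hlow i ((1 - t) * m₀ i + t * mh i)).trans ?_
          refine le_trans (le_of_eq ?_) (lossTerm_convex hl ht0 ht1 _ _ _ _)
          rw [inner_smul_right]
          congr 1
          ring
      _ = (1 - t) * ∑ i, Q i (r₀ i) +
            t * ∑ i, lossTerm l (r₀ i - inner ℝ (x i) u) (mh i) := by
          rw [Finset.sum_add_distrib, ← Finset.mul_sum, ← Finset.mul_sum,
            Finset.sum_congr rfl fun i _ => hQ0 i]
      _ ≤ _ := by nlinarith
  have hdiff : ∑ i, Q i (r₀ i - inner ℝ (x i) (t • u)) - ∑ i, Q i (r₀ i) =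
      ∑ i ∈ smallIdx n s, inner ℝ (x i) (t • u) ^ 2 -
        2 * inner ℝ (∑ i ∈ smallIdx n s, (mu i + e i) • x i +
          l • ∑ i ∈ largeIdx n s, sgn (mu i) • x i) (t • u) := by
    rw [← Finset.sum_sub_distrib, inner_add_left, inner_smul_left, sum_inner, sum_inner]
    have : ∀ i, Q i (r₀ i - inner ℝ (x i) (t • u)) - Q i (r₀ i) =
        if i.val < s then -(2 * l * (sgn (mu i) * inner ℝ (x i) (t • u))) else
          inner ℝ (x i) (t • u) ^ 2 - 2 * (r₀ i * inner ℝ (x i) (t • u)) := by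
      intro i
      simp only [hQ]
      split_ifs <;> ring
    simp only [this]
    rw [sum_ite_lt]
    simp only [inner_smul_left, Finset.sum_sub_distrib, Finset.sum_neg_distrib,
      ← Finset.mul_sum, hr₀]
    simp
    ring
  have h1 := hcoer (t • u)
  have h2 := real_inner_le_norm (∑ i ∈ smallIdx n s, (mu i + e i) • x i +
          l • ∑ i ∈ largeIdx n s, sgn (mu i) • x i) (t • u)
  rw [hv] at h1 h2
  nlinarith

/-- A minimizer of the penalized loss minimizes each term of the loss. -/
theorem lossTerm_le_of_isMinOn {n d : ℕ} {x : Fin n → EuclideanSpace ℝ (Fin d)}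
    {mu e mh : Fin n → ℝ} {β u : EuclideanSpace ℝ (Fin d)} {l : ℝ}
    (hmin : IsMinOn (penalizedLoss l x (response mu x β e)) Set.univ (mh, β + u))
    (i : Fin n) (m : ℝ) :
    lossTerm l (mu i + e i - inner ℝ (x i) u) (mh i) ≤
      lossTerm l (mu i + e i - inner ℝ (x i) u) m := by
  have h := hmin (Set.mem_univ (Function.update mh i m, β + u))
  simp only [Set.mem_ofPred_eq, penalizedLoss_add] at h
  by_contra hlt
  push Not at hlt
  refine absurd h (not_le.2 (Finset.sum_lt_sum (fun j _ => ?_) ⟨i, Finset.mem_univ i, ?_⟩))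
  · by_cases hj : j = i
    · subst hj; simpa using hlt.le
    · rw [Function.update_of_ne hj]
  · simpa using hlt

/-- On a favourable sample, the penalized estimator detects exactly the large incidental
parameters. -/
theorem zeroIndices_eq_smallIdx {n d s : ℕ} {x : Fin n → EuclideanSpace ℝ (Fin d)}
    {mu e mh : Fin n → ℝ} {β βh : EuclideanSpace ℝ (Fin d)} {l R b k γ α : ℝ}
    (hα : 2 < α) (hγ : 0 < γ) (hl : α * γ ≤ l) (hR : 0 < R)
    (hkR : k * R ≤ (1 - 2 / α) / 2 * l)
    (hx : ∀ i, ‖x i‖ ≤ k) (he : ∀ i, |e i| ≤ γ)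
    (hlarge : ∀ i : Fin n, i.val < s → 3 * l ≤ |mu i|)
    (hsmall : ∀ i : Fin n, s ≤ i.val → |mu i| ≤ γ)
    (hcoer : ∀ v : EuclideanSpace ℝ (Fin d),
      b * ‖v‖ ^ 2 ≤ ∑ i ∈ smallIdx n s, inner ℝ (x i) v ^ 2)
    (hscore : 2 * ‖∑ i ∈ smallIdx n s, (mu i + e i) • x i +
      l • ∑ i ∈ largeIdx n s, sgn (mu i) • x i‖ < b * R)
    (hmin : IsMinOn (penalizedLoss l x (response mu x β e)) Set.univ (mh, βh)) :
    zeroIndices mh = smallIdx n s := by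
  obtain ⟨u, rfl⟩ : ∃ u, βh = β + u := ⟨βh - β, by simp⟩
  have hl0 : 0 < l := lt_of_lt_of_le (by positivity) hl
  have hγl : γ ≤ l / α := (le_div_iff₀ (by linarith)).2 (by linarith)
  have hγl' : l / α = (2 / α) / 2 * l := by ring
  have hα2 : 0 < 2 / α := by positivity
  have hα3 : 2 / α < 1 := (div_lt_one (by linarith)).2 hα
  have hinner : ∀ i v, ‖v‖ ≤ R → |inner ℝ (x i) v| ≤ (1 - 2 / α) / 2 * l := by
    intro i v hv
    refine (abs_real_inner_le_norm _ _).trans (le_trans ?_ hkR)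
    exact mul_le_mul (hx i) hv (norm_nonneg _) ((norm_nonneg _).trans (hx i))
  have hγl2 : γ ≤ l / 2 := by nlinarith
  have hsm : ∀ i : Fin n, s ≤ i.val → ∀ v : EuclideanSpace ℝ (Fin d), ‖v‖ ≤ R →
      |mu i + e i - inner ℝ (x i) v| < l := by
    intro i hi v hv
    have h1 := hinner i v hv
    have h2 := abs_sub (mu i + e i) (inner ℝ (x i) v)
    have h3 := abs_add_le (mu i) (e i)
    have h4 := he i
    have h5 := hsmall i hi
    nlinarith
  have hlg : ∀ i : Fin n, i.val < s → ∀ v : EuclideanSpace ℝ (Fin d), ‖v‖ ≤ R →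
      l < sgn (mu i) * (mu i + e i - inner ℝ (x i) v) := by
    intro i hi v hv
    have h1 := hinner i v hv
    have h6 : |sgn (mu i) * (e i - inner ℝ (x i) v)| ≤ |e i| + |inner ℝ (x i) v| := by
      rw [abs_mul, abs_sgn, one_mul]; exact abs_sub _ _
    have h7 := neg_abs_le (sgn (mu i) * (e i - inner ℝ (x i) v))
    have h8 := sgn_mul_self (mu i)
    have h9 := hlarge i hi
    have h4 := he i
    have h10 : sgn (mu i) * (mu i + e i - inner ℝ (x i) v) =
      sgn (mu i) * mu i + sgn (mu i) * (e i - inner ℝ (x i) v) := by ring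
    rw [h10, h8]
    nlinarith
  have hu : ‖u‖ ≤ R := by
    refine norm_le_of_isMinOn hl0.le hR (fun i hi => ?_) (fun i hi v hv => (hsm i hi v hv).le)
      hcoer hscore hmin
    simpa using (hlg i hi 0 (by simpa using hR.le)).le
  ext i
  simp only [zeroIndices, smallIdx, Finset.mem_filter, Finset.mem_univ, true_and]
  constructor
  · intro hi
    by_contra hlt
    push Not at hlt
    have h1 := hlg i hlt u hu
    have h2 := lossTerm_le_of_isMinOn hmin i
      ((mu i + e i - inner ℝ (x i) u) - l * sgn (mu i))
    rw [lossTerm_sub_eq h1.le, hi] at h2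
    set r := mu i + e i - inner ℝ (x i) u
    have h3 : lossTerm l r 0 = r ^ 2 := by simp [lossTerm]
    have h4 : (sgn (mu i) * r) ^ 2 = r ^ 2 := by rw [mul_pow, sgn_sq, one_mul]
    rw [h3, ← h4] at h2
    nlinarith
  · intro hi
    by_contra hne
    have h1 := hsm i hi u hu
    have h2 := lossTerm_le_of_isMinOn hmin i 0
    set r := mu i + e i - inner ℝ (x i) u
    have h3 : lossTerm l r 0 = r ^ 2 := by simp [lossTerm]
    have h4 := sq_add_le_lossTerm l r (mh i)
    have h5 : 0 < |mh i| := abs_pos.2 hne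
    have h6 : 0 < |mh i| * (l - |r|) := mul_pos h5 (by linarith)
    nlinarith [sq_nonneg (mh i)]

/-- The Gram matrix `∑_{i ∈ I} xᵢ xᵢᵀ`. -/
def gram {n d : ℕ} (x : Fin n → EuclideanSpace ℝ (Fin d)) (I : Finset (Fin n)) :
    Matrix (Fin d) (Fin d) ℝ :=
  Matrix.of fun j k => ∑ i ∈ I, x i j * x i k

theorem designOn_transpose_mul_self {n d : ℕ} (x : Fin n → EuclideanSpace ℝ (Fin d))
    (I : Finset (Fin n)) : (designOn x I)ᵀ * designOn x I = gram x I := by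
  ext j k
  simp only [Matrix.mul_apply, Matrix.transpose_apply, designOn, gram, Matrix.of_apply]
  exact Finset.sum_coe_sort I fun i => x i j * x i k

theorem designOn_transpose_mulVec {n d : ℕ} (x : Fin n → EuclideanSpace ℝ (Fin d))
    (I : Finset (Fin n)) (y : Fin n → ℝ) :
    (designOn x I)ᵀ *ᵥ (fun i : I => y i.1) = (∑ i ∈ I, y i • x i : EuclideanSpace ℝ (Fin d)) := by
  ext j
  simp only [Matrix.mulVec, dotProduct, Matrix.transpose_apply, designOn, Matrix.of_apply,
    WithLp.ofLp_sum, Finset.sum_apply, smul_eq_mul, WithLp.ofLp_smul, Pi.smul_apply]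
  rw [Finset.sum_coe_sort I fun i => x i j * y i]
  exact Finset.sum_congr rfl fun i _ => mul_comm _ _

theorem inner_eq_dotProduct {d : ℕ} (u v : EuclideanSpace ℝ (Fin d)) :
    inner ℝ u v = u.ofLp ⬝ᵥ v.ofLp := by
  simp [PiLp.inner_apply, dotProduct, mul_comm]

theorem gram_mulVec {n d : ℕ} (x : Fin n → EuclideanSpace ℝ (Fin d))
    (I : Finset (Fin n)) (u : EuclideanSpace ℝ (Fin d)) :
    gram x I *ᵥ u.ofLp = (∑ i ∈ I, inner ℝ (x i) u • x i : EuclideanSpace ℝ (Fin d)) := by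
  ext j
  simp only [gram, Matrix.mulVec, dotProduct, Matrix.of_apply, WithLp.ofLp_sum, Finset.sum_apply,
    WithLp.ofLp_smul, Pi.smul_apply, smul_eq_mul, inner_eq_dotProduct, Finset.sum_mul]
  rw [Finset.sum_comm]
  exact Finset.sum_congr rfl fun i _ => Finset.sum_congr rfl fun k _ => by ring

theorem dotProduct_gram_mulVec {n d : ℕ} (x : Fin n → EuclideanSpace ℝ (Fin d))
    (I : Finset (Fin n)) (u : EuclideanSpace ℝ (Fin d)) :
    u.ofLp ⬝ᵥ gram x I *ᵥ u.ofLp = ∑ i ∈ I, inner ℝ (x i) u ^ 2 := by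
  rw [gram_mulVec, ← inner_eq_dotProduct, inner_sum]
  refine Finset.sum_congr rfl fun i _ => ?_
  rw [inner_smul_right, real_inner_comm, sq]

theorem normF_nonneg {m n : ℕ} (M : Matrix (Fin m) (Fin n) ℝ) : 0 ≤ normF M := Real.sqrt_nonneg _

theorem norm_mulVec_le {m n : ℕ} (M : Matrix (Fin m) (Fin n) ℝ) (v : EuclideanSpace ℝ (Fin n)) :
    ‖WithLp.toLp 2 (M *ᵥ v.ofLp)‖ ≤ normF M * ‖v‖ := by
  rw [EuclideanSpace.norm_eq, EuclideanSpace.norm_eq, normF, ← Real.sqrt_mul (by positivity)]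
  refine Real.sqrt_le_sqrt ?_
  rw [Finset.sum_mul]
  refine Finset.sum_le_sum fun i _ => ?_
  simp only [Real.norm_eq_abs, sq_abs, Matrix.mulVec, dotProduct]
  exact Finset.sum_mul_sq_le_sq_mul_sq _ _ _

theorem normF_transpose {m n : ℕ} (M : Matrix (Fin m) (Fin n) ℝ) : normF Mᵀ = normF M := by
  unfold normF
  rw [Finset.sum_comm]
  rfl

theorem abs_dotProduct_mulVec_le {d : ℕ} (M : Matrix (Fin d) (Fin d) ℝ)
    (u : EuclideanSpace ℝ (Fin d)) : |u.ofLp ⬝ᵥ M *ᵥ u.ofLp| ≤ normF M * ‖u‖ ^ 2 := by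
  have h := abs_real_inner_le_norm u (WithLp.toLp 2 (M *ᵥ u.ofLp))
  rw [inner_eq_dotProduct] at h
  refine h.trans ?_
  have := norm_mulVec_le M u
  nlinarith [norm_nonneg u]

/-- The quadratic form of `M` is bounded below by `c ‖u‖²`. -/
def Coercive {d : ℕ} (c : ℝ) (M : Matrix (Fin d) (Fin d) ℝ) : Prop :=
  ∀ u : EuclideanSpace ℝ (Fin d), c * ‖u‖ ^ 2 ≤ u.ofLp ⬝ᵥ M *ᵥ u.ofLp

theorem Coercive.norm_le {d : ℕ} {c : ℝ} {M : Matrix (Fin d) (Fin d) ℝ} (h : Coercive c M)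
    (hc : 0 < c) {u v : EuclideanSpace ℝ (Fin d)} (huv : M *ᵥ u.ofLp = v.ofLp) :
    ‖u‖ ≤ ‖v‖ / c := by
  have h1 := h u
  rw [huv, ← inner_eq_dotProduct] at h1
  have h2 := h1.trans (real_inner_le_norm u v)
  rw [le_div_iff₀ hc]
  rcases (norm_nonneg u).eq_or_lt with h0 | h0
  · rw [← h0]; simp
  · have : ‖u‖ * (‖u‖ * c) ≤ ‖u‖ * ‖v‖ := by nlinarith
    exact le_of_mul_le_mul_left this h0

theorem Coercive.isUnit_det {d : ℕ} {c : ℝ} {M : Matrix (Fin d) (Fin d) ℝ} (h : Coercive c M)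
    (hc : 0 < c) : IsUnit M.det := by
  rw [isUnit_iff_ne_zero]
  intro h0
  obtain ⟨v, hv, hMv⟩ := Matrix.exists_mulVec_eq_zero_iff.2 h0
  have := h.norm_le hc (u := WithLp.toLp 2 v) (v := 0) (by simpa using hMv)
  rw [norm_zero, zero_div] at this
  have h1 := norm_le_zero_iff.1 this
  exact hv (by simpa using congrArg WithLp.ofLp h1)

theorem coercive_of_le_lamMin {d : ℕ} {c : ℝ} {M : Matrix (Fin d) (Fin d) ℝ}
    (hM : M.IsHermitian) (hc : c ≤ lamMin M) : Coercive c M := by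
  have hfin : (spectrum ℝ M).Finite := Matrix.finite_spectrum M
  have hps : (M - c • (1 : Matrix (Fin d) (Fin d) ℝ)).PosSemidef := by
    rw [Matrix.posSemidef_iff_isHermitian_and_spectrum_nonneg]
    refine ⟨hM.sub ?_, ?_⟩
    · simp [Matrix.IsHermitian]
    · intro a ha
      have he : M - c • (1 : Matrix (Fin d) (Fin d) ℝ) = M - algebraMap ℝ _ c := by
        rw [Algebra.algebraMap_eq_smul_one]
      rw [he, ← spectrum.sub_singleton_eq] at ha
      obtain ⟨y, hy, z, hz, rfl⟩ := Set.mem_sub.1 ha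
      rw [Set.mem_singleton_iff.1 hz]
      have : lamMin M ≤ y := csInf_le hfin.bddBelow hy
      show 0 ≤ y - c
      linarith
  intro u
  have h := hps.dotProduct_mulVec_nonneg u.ofLp
  rw [Matrix.sub_mulVec, dotProduct_sub, Matrix.smul_mulVec, Matrix.one_mulVec,
    dotProduct_smul] at h
  have h2 : u.ofLp ⬝ᵥ u.ofLp = ‖u‖ ^ 2 := by
    rw [← inner_eq_dotProduct, real_inner_self_eq_norm_sq]
  simp only [star_trivial, smul_eq_mul, h2] at h
  linarith

theorem Coercive.of_normF_sub_le {d : ℕ} {c c' m η : ℝ} {M S : Matrix (Fin d) (Fin d) ℝ}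
    (h : Coercive c M) (hm : 0 ≤ m) (hS : normF (S - m • M) ≤ η) (hc : c' ≤ m * c - η) :
    Coercive c' S := by
  intro u
  have h1 := (abs_le.1 (abs_dotProduct_mulVec_le (S - m • M) u)).1
  rw [Matrix.sub_mulVec, dotProduct_sub, Matrix.smul_mulVec, dotProduct_smul, smul_eq_mul] at h1
  have h2 := mul_le_mul_of_nonneg_left (h u) hm
  have h3 := mul_le_mul_of_nonneg_right hS (sq_nonneg ‖u‖)
  have h4 := mul_le_mul_of_nonneg_right hc (sq_nonneg ‖u‖)
  nlinarith

/-- The normal equations of least squares with incidental parameters. -/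
theorem gram_mulVec_leastSquaresOn_sub {n d : ℕ} {x : Fin n → EuclideanSpace ℝ (Fin d)}
    {I : Finset (Fin n)} (hdet : IsUnit (gram x I).det) (mu e : Fin n → ℝ)
    (β : EuclideanSpace ℝ (Fin d)) :
    gram x I *ᵥ (leastSquaresOn x (response mu x β e) I - β).ofLp =
      (∑ i ∈ I, e i • x i + ∑ i ∈ I, mu i • x i : EuclideanSpace ℝ (Fin d)).ofLp := by
  rw [WithLp.ofLp_sub, Matrix.mulVec_sub, leastSquaresOn, designOn_transpose_mul_self]
  simp only
  rw [Matrix.mulVec_mulVec, Matrix.mul_nonsing_inv _ hdet, Matrix.one_mulVec,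
    designOn_transpose_mulVec, gram_mulVec, ← WithLp.ofLp_sub, ← Finset.sum_sub_distrib,
    ← Finset.sum_add_distrib]
  congr 1
  refine Finset.sum_congr rfl fun i _ => ?_
  rw [← sub_smul, ← add_smul]
  congr 1
  unfold response
  ring

/-- The linear approximation of the error of least squares. -/
theorem norm_leastSquaresOn_sub_sub_le {n d : ℕ} {x : Fin n → EuclideanSpace ℝ (Fin d)}
    {I : Finset (Fin n)} {mu e : Fin n → ℝ} {β : EuclideanSpace ℝ (Fin d)}
    {M : Matrix (Fin d) (Fin d) ℝ} {c c' m η : ℝ} (hM : Coercive c M) (hc : 0 < c) (hm : 0 < m)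
    (hS : normF (gram x I - m • M) ≤ η) (hc0 : 0 < c') (hc' : c' ≤ m * c - η) :
    ‖(leastSquaresOn x (response mu x β e) I - β) -
        WithLp.toLp 2 (m⁻¹ • (M⁻¹ *ᵥ (∑ i ∈ I, e i • x i : EuclideanSpace ℝ (Fin d)).ofLp))‖ ≤
      (‖∑ i ∈ I, mu i • x i‖ + η * (‖∑ i ∈ I, e i • x i‖ / (m * c))) / c' := by
  have hScoer : Coercive c' (gram x I) := hM.of_normF_sub_le hm.le hS hc'
  set v₁ : EuclideanSpace ℝ (Fin d) := ∑ i ∈ I, e i • x i with hv₁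
  set v₂ : EuclideanSpace ℝ (Fin d) := ∑ i ∈ I, mu i • x i with hv₂
  set z : EuclideanSpace ℝ (Fin d) := WithLp.toLp 2 (m⁻¹ • (M⁻¹ *ᵥ v₁.ofLp)) with hz
  have hMz : (m • M) *ᵥ z.ofLp = v₁.ofLp := by
    simp only [hz]
    rw [Matrix.mulVec_smul, Matrix.smul_mulVec, smul_smul, inv_mul_cancel₀ hm.ne', one_smul,
      Matrix.mulVec_mulVec, Matrix.mul_nonsing_inv _ (hM.isUnit_det hc), Matrix.one_mulVec]
  have hmM : Coercive (m * c) (m • M) := by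
    intro u
    rw [Matrix.smul_mulVec, dotProduct_smul, smul_eq_mul, mul_assoc]
    exact mul_le_mul_of_nonneg_left (hM u) hm.le
  have hznorm : ‖z‖ ≤ ‖v₁‖ / (m * c) := hmM.norm_le (by positivity) hMz
  have hnormal := gram_mulVec_leastSquaresOn_sub (hScoer.isUnit_det hc0) mu e β
  have hres : gram x I *ᵥ ((leastSquaresOn x (response mu x β e) I - β) - z).ofLp =
      (v₂ - WithLp.toLp 2 ((gram x I - m • M) *ᵥ z.ofLp) : EuclideanSpace ℝ (Fin d)).ofLp := by
    rw [WithLp.ofLp_sub, Matrix.mulVec_sub, hnormal, WithLp.ofLp_add, WithLp.ofLp_sub,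
      Matrix.sub_mulVec, hMz]
    change v₁.ofLp + v₂.ofLp - _ = v₂.ofLp - (_ - v₁.ofLp)
    abel
  refine (hScoer.norm_le hc0 hres).trans ?_
  refine div_le_div_of_nonneg_right ((norm_sub_le _ _).trans (add_le_add le_rfl ?_)) hc0.le
  exact (norm_mulVec_le _ _).trans
    (mul_le_mul hS hznorm (norm_nonneg _) ((normF_nonneg _).trans hS))

theorem integral_mul_le_sqrt {E : Type*} [MeasurableSpace E] {μ : Measure E} {f g : E → ℝ}
    (hf : MemLp f 2 μ) (hg : MemLp g 2 μ) (hf0 : ∀ x, 0 ≤ f x) (hg0 : ∀ x, 0 ≤ g x) :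
    ∫ x, f x * g x ∂μ ≤ √(∫ x, f x ^ 2 ∂μ) * √(∫ x, g x ^ 2 ∂μ) := by
  have h := integral_mul_le_Lp_mul_Lq_of_nonneg (μ := μ) Real.HolderConjugate.two_two
    (Eventually.of_forall hf0) (Eventually.of_forall hg0) (by simpa using hf) (by simpa using hg)
  simpa [Real.sqrt_eq_rpow] using h

theorem memLp_two_sq {E : Type*} [MeasurableSpace E] {μ : Measure E} {f : E → ℝ}
    (hf : MemLp f 4 μ) : MemLp (fun x => f x ^ 2) 2 μ := by
  refine (memLp_two_iff_integrable_sq (hf.aestronglyMeasurable.pow 2)).2 ?_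
  have h := hf.integrable_norm_pow (p := 4) (by norm_num)
  refine h.congr (Eventually.of_forall fun x => ?_)
  change |f x| ^ 4 = (f x ^ 2) ^ 2
  rw [← pow_mul, ← abs_pow, abs_of_nonneg (by positivity)]

theorem memLp_two_mul {E : Type*} [MeasurableSpace E] {μ : Measure E} {f g : E → ℝ}
    (hf : MemLp f 4 μ) (hg : MemLp g 4 μ) : MemLp (fun x => f x * g x) 2 μ := by
  refine (memLp_two_iff_integrable_sq
    (hf.aestronglyMeasurable.mul hg.aestronglyMeasurable)).2 ?_
  refine ((memLp_two_sq hf).integrable_mul (memLp_two_sq hg)).congr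
    (Eventually.of_forall fun x => ?_)
  simp [mul_pow]

section Moments

variable {d : ℕ} {ξ : Measure (EuclideanSpace ℝ (Fin d))}

theorem sum_sqrt_eq_kappaX (ξ : Measure (EuclideanSpace ℝ (Fin d))) :
    ∑ j : Fin d, √(∫ x, x j ^ 4 ∂ξ) = d * kappaX ξ := by
  unfold kappaX
  rcases Nat.eq_zero_or_pos d with h | h
  · subst h; simp
  · rw [mul_inv_cancel_left₀ (by positivity)]

theorem integral_sq_le_sqrt [IsProbabilityMeasure ξ]
    (h4 : ∀ j, MemLp (fun x : EuclideanSpace ℝ (Fin d) => x j) 4 ξ)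
    (j : Fin d) : ∫ x, x j ^ 2 ∂ξ ≤ √(∫ x, x j ^ 4 ∂ξ) := by
  have h := integral_mul_le_sqrt (memLp_two_sq (h4 j)) (memLp_const (1 : ℝ))
    (fun x => sq_nonneg _) (fun _ => zero_le_one)
  simpa [← pow_mul] using h

theorem integral_sq_mul_sq_le (h4 : ∀ j, MemLp (fun x : EuclideanSpace ℝ (Fin d) => x j) 4 ξ)
    (j k : Fin d) :
    ∫ x, (x j * x k) ^ 2 ∂ξ ≤ √(∫ x, x j ^ 4 ∂ξ) * √(∫ x, x k ^ 4 ∂ξ) := by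
  have h := integral_mul_le_sqrt (memLp_two_sq (h4 j)) (memLp_two_sq (h4 k))
    (fun x => sq_nonneg _) (fun x => sq_nonneg _)
  simpa [← pow_mul, mul_pow] using h

theorem sum_integral_sq_le [IsProbabilityMeasure ξ]
    (h4 : ∀ j, MemLp (fun x : EuclideanSpace ℝ (Fin d) => x j) 4 ξ) :
    ∑ j, ∫ x, x j ^ 2 ∂ξ ≤ d * kappaX ξ := by
  rw [← sum_sqrt_eq_kappaX]
  exact Finset.sum_le_sum fun j _ => integral_sq_le_sqrt h4 j

theorem sum_integral_mul_sq_le (h4 : ∀ j, MemLp (fun x : EuclideanSpace ℝ (Fin d) => x j) 4 ξ) :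
    ∑ p : Fin d × Fin d, ∫ x, (x p.1 * x p.2) ^ 2 ∂ξ ≤ (d * kappaX ξ) ^ 2 := by
  rw [← sum_sqrt_eq_kappaX, sq, Finset.sum_mul_sum, Fintype.sum_prod_type]
  exact Finset.sum_le_sum fun j _ => Finset.sum_le_sum fun k _ => integral_sq_mul_sq_le h4 j k

theorem norm_pow_four_eq (x : EuclideanSpace ℝ (Fin d)) :
    ‖x‖ ^ 4 = ∑ p : Fin d × Fin d, (x p.1 * x p.2) ^ 2 := by
  rw [show ‖x‖ ^ 4 = ‖x‖ ^ 2 * ‖x‖ ^ 2 by ring, EuclideanSpace.real_norm_sq_eq,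
    Finset.sum_mul_sum, Fintype.sum_prod_type]
  simp only [mul_pow]

theorem integrable_norm_pow_four
    (h4 : ∀ j, MemLp (fun x : EuclideanSpace ℝ (Fin d) => x j) 4 ξ) :
    Integrable (fun x => ‖x‖ ^ 4) ξ := by
  simp only [norm_pow_four_eq]
  exact integrable_finsetSum _ fun p _ => (memLp_two_mul (h4 p.1) (h4 p.2)).integrable_sq

theorem integral_norm_pow_four_le
    (h4 : ∀ j, MemLp (fun x : EuclideanSpace ℝ (Fin d) => x j) 4 ξ) :
    ∫ x, ‖x‖ ^ 4 ∂ξ ≤ (d * kappaX ξ) ^ 2 := by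
  simp only [norm_pow_four_eq]
  rw [integral_finsetSum _ fun p _ => (memLp_two_mul (h4 p.1) (h4 p.2)).integrable_sq]
  exact sum_integral_mul_sq_le h4

theorem covMat_apply (h0 : ∀ j, ∫ x, x j ∂ξ = 0) (j k : Fin d) :
    covMat ξ j k = ∫ x, x j * x k ∂ξ := by
  simp [covMat, covariance, h0]

theorem memLp_inner {p : ENNReal}
    (hp : ∀ j, MemLp (fun x : EuclideanSpace ℝ (Fin d) => x j) p ξ)
    (a : EuclideanSpace ℝ (Fin d)) : MemLp (fun x => inner ℝ a x) p ξ := by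
  simp only [inner_eq_dotProduct, dotProduct]
  exact memLp_finsetSum _ fun j _ => (hp j).const_mul _

theorem integral_inner_sq (h2 : ∀ j, MemLp (fun x : EuclideanSpace ℝ (Fin d) => x j) 2 ξ)
    (h0 : ∀ j, ∫ x, x j ∂ξ = 0) (a : EuclideanSpace ℝ (Fin d)) :
    ∫ x, inner ℝ a x ^ 2 ∂ξ = a.ofLp ⬝ᵥ covMat ξ *ᵥ a.ofLp := by
  have hi : ∀ j k, Integrable (fun x : EuclideanSpace ℝ (Fin d) => x j * x k) ξ :=
    fun j k => (h2 j).integrable_mul (h2 k)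
  have he : ∀ x : EuclideanSpace ℝ (Fin d),
      inner ℝ a x ^ 2 = ∑ j, ∑ k, a j * a k * (x j * x k) := by
    intro x
    rw [inner_eq_dotProduct, dotProduct, sq, Finset.sum_mul_sum]
    exact Finset.sum_congr rfl fun j _ => Finset.sum_congr rfl fun k _ => by ring
  simp only [he]
  rw [integral_finsetSum _ fun j _ => integrable_finsetSum _ fun k _ => (hi j k).const_mul _]
  simp only [dotProduct, Matrix.mulVec, Finset.mul_sum]
  refine Finset.sum_congr rfl fun j _ => ?_
  rw [integral_finsetSum _ fun k _ => (hi j k).const_mul _]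
  refine Finset.sum_congr rfl fun k _ => ?_
  rw [integral_const_mul, covMat_apply h0]
  ring

theorem abs_inner_pow_three_le (hd : 0 < d) (a x : EuclideanSpace ℝ (Fin d)) :
    |(inner ℝ a x : ℝ)| ^ 3 ≤ d * inner ℝ a x ^ 2 + ‖a‖ ^ 4 * ‖x‖ ^ 4 / d := by
  have hd' : (0 : ℝ) < d := by exact_mod_cast hd
  set w := |(inner ℝ a x : ℝ)| with hw
  have hw0 : 0 ≤ w := abs_nonneg _
  have h1 : w ≤ ‖a‖ * ‖x‖ := abs_real_inner_le_norm a x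
  have h2 : w ^ 4 ≤ ‖a‖ ^ 4 * ‖x‖ ^ 4 := by
    rw [← mul_pow]; exact pow_le_pow_left₀ hw0 h1 4
  have h3 : w ^ 3 * d ≤ d * w ^ 2 * d + w ^ 4 := by
    nlinarith [mul_nonneg (sq_nonneg w) (sq_nonneg (w - 2 * d)), sq_nonneg (w ^ 2)]
  rw [← sq_abs (inner ℝ a x), ← hw]
  have h4 : d * w ^ 2 + w ^ 4 / d ≤ d * w ^ 2 + ‖a‖ ^ 4 * ‖x‖ ^ 4 / d := by gcongr
  refine le_trans ?_ h4
  rw [← sub_nonneg]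
  have : d * w ^ 2 + w ^ 4 / d - w ^ 3 = (d * w ^ 2 * d + w ^ 4 - w ^ 3 * d) / d := by
    field_simp
  rw [this]
  exact div_nonneg (by linarith) hd'.le

theorem integrable_abs_inner_pow_three [IsProbabilityMeasure ξ]
    (h4 : ∀ j, MemLp (fun x : EuclideanSpace ℝ (Fin d) => x j) 4 ξ)
    (a : EuclideanSpace ℝ (Fin d)) : Integrable (fun x => |(inner ℝ a x : ℝ)| ^ 3) ξ := by
  have h : MemLp (fun x => (inner ℝ a x : ℝ)) 3 ξ :=
    (memLp_inner h4 a).mono_exponent (by norm_num)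
  simpa using h.integrable_norm_pow (p := 3) (by norm_num)

theorem integral_abs_inner_pow_three_le [IsProbabilityMeasure ξ] (hd : 0 < d)
    (h4 : ∀ j, MemLp (fun x : EuclideanSpace ℝ (Fin d) => x j) 4 ξ)
    (h0 : ∀ j, ∫ x, x j ∂ξ = 0) (a : EuclideanSpace ℝ (Fin d)) :
    ∫ x, |(inner ℝ a x : ℝ)| ^ 3 ∂ξ ≤
      d * (a.ofLp ⬝ᵥ covMat ξ *ᵥ a.ofLp) + d * (‖a‖ ^ 4 * kappaX ξ ^ 2) := by
  have h2 : ∀ j, MemLp (fun x : EuclideanSpace ℝ (Fin d) => x j) 2 ξ :=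
    fun j => (h4 j).mono_exponent (by norm_num)
  have i1 : Integrable (fun x => (d : ℝ) * inner ℝ a x ^ 2) ξ :=
    (memLp_inner h2 a).integrable_sq.const_mul _
  have i2 : Integrable (fun x => ‖a‖ ^ 4 * ‖x‖ ^ 4 / d) ξ :=
    ((integrable_norm_pow_four h4).const_mul _).div_const _
  calc _ ≤ ∫ x, ((d : ℝ) * inner ℝ a x ^ 2 + ‖a‖ ^ 4 * ‖x‖ ^ 4 / d) ∂ξ :=
        integral_mono (integrable_abs_inner_pow_three h4 a) (i1.add i2)
          fun x => abs_inner_pow_three_le hd a x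
    _ = d * (a.ofLp ⬝ᵥ covMat ξ *ᵥ a.ofLp) + ‖a‖ ^ 4 * (∫ x, ‖x‖ ^ 4 ∂ξ) / d := by
        rw [integral_add i1 i2, integral_const_mul, integral_inner_sq h2 h0, integral_div,
          integral_const_mul]
    _ ≤ _ := by
        have h := integral_norm_pow_four_le h4
        have hd' : (0 : ℝ) < d := by exact_mod_cast hd
        refine add_le_add le_rfl ?_
        rw [div_le_iff₀ hd']
        calc _ ≤ ‖a‖ ^ 4 * (d * kappaX ξ) ^ 2 := by gcongr
          _ = _ := by ring

variable {ν : Measure ℝ} [IsProbabilityMeasure ν] {Ω : Type*} [MeasurableSpace Ω]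
  {P : Measure Ω} [IsProbabilityMeasure P] {n : ℕ}
  {U : Fin n → Ω → EuclideanSpace ℝ (Fin d) × ℝ}

theorem norm_sq_sum_smul (I : Finset (Fin n)) (c : Fin n → ℝ)
    (x : Fin n → EuclideanSpace ℝ (Fin d)) :
    ‖∑ i ∈ I, c i • x i‖ ^ 2 = ∑ j, (∑ i ∈ I, c i * x i j) ^ 2 := by
  rw [EuclideanSpace.real_norm_sq_eq]
  simp

/-- Tail bound for the norm of the noise part of the score. -/
theorem measure_noise_le [IsProbabilityMeasure ξ] (hind : iIndepFun U P)
    (hlaw : ∀ i, HasLaw (U i) (ξ.prod ν) P)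
    (h4 : ∀ j, MemLp (fun x : EuclideanSpace ℝ (Fin d) => x j) 4 ξ)
    (hν : MemLp id 2 ν) (hν0 : ∫ y, y ∂ν = 0) (I : Finset (Fin n)) {M : ℝ} (hM : 0 < M) :
    P {ω | M < ‖∑ i ∈ I, (U i ω).2 • (U i ω).1‖} ≤
      ENNReal.ofReal (n * (d * kappaX ξ * ∫ y, y ^ 2 ∂ν) / M ^ 2) := by
  have h2 : ∀ j, MemLp (fun x : EuclideanSpace ℝ (Fin d) => x j) 2 ξ :=
    fun j => (h4 j).mono_exponent (by norm_num)
  have hν2 : Integrable (fun y : ℝ => y ^ 2) ν := by simpa using hν.integrable_sq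
  have hsq : ∀ j, ∫ z : EuclideanSpace ℝ (Fin d) × ℝ, (z.1 j * z.2) ^ 2 ∂(ξ.prod ν) =
      (∫ x, x j ^ 2 ∂ξ) * ∫ y, y ^ 2 ∂ν := by
    intro j
    rw [← integral_prod_mul (fun x : EuclideanSpace ℝ (Fin d) => x j ^ 2) (fun y : ℝ => y ^ 2)]
    simp only [mul_pow]
  have h := measure_sum_sq_ge_le hind hlaw
    (f := fun (j : Fin d) (z : EuclideanSpace ℝ (Fin d) × ℝ) => z.1 j * z.2)
    (fun j => by fun_prop) (fun j => by
      rw [memLp_two_iff_integrable_sq (by fun_prop)]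
      refine ((h2 j).integrable_sq.mul_prod hν2).congr (Eventually.of_forall fun z => ?_)
      simp [mul_pow])
    (fun j => by
      rw [integral_prod_mul (fun x : EuclideanSpace ℝ (Fin d) => x j) (fun y : ℝ => y), hν0,
        mul_zero])
    (c := fun _ => 1) (fun _ => by simp) I hM
  refine (measure_mono fun ω hω => ?_).trans (h.trans (ENNReal.ofReal_le_ofReal ?_))
  · have hω' : M < ‖∑ i ∈ I, (U i ω).2 • (U i ω).1‖ := hω
    have := pow_le_pow_left₀ hM.le hω'.le 2
    rw [norm_sq_sum_smul] at this
    simpa [mul_comm] using this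
  · simp only [hsq]
    rw [← Finset.sum_mul]
    have := sum_integral_sq_le h4
    have h3 : 0 ≤ ∫ y, y ^ 2 ∂ν := integral_nonneg fun y => sq_nonneg _
    gcongr

/-- Tail bound for the norm of a signed sum of covariates. -/
theorem measure_signed_sum_le [IsProbabilityMeasure ξ] (hind : iIndepFun U P)
    (hlaw : ∀ i, HasLaw (U i) (ξ.prod ν) P)
    (h4 : ∀ j, MemLp (fun x : EuclideanSpace ℝ (Fin d) => x j) 4 ξ)
    (h0 : ∀ j, ∫ x, x j ∂ξ = 0) {c : Fin n → ℝ} (hc : ∀ i, |c i| ≤ 1)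
    (I : Finset (Fin n)) {M : ℝ} (hM : 0 < M) :
    P {ω | M < ‖∑ i ∈ I, c i • (U i ω).1‖} ≤
      ENNReal.ofReal (n * (d * kappaX ξ) / M ^ 2) := by
  have h2 : ∀ j, MemLp (fun x : EuclideanSpace ℝ (Fin d) => x j) 2 ξ :=
    fun j => (h4 j).mono_exponent (by norm_num)
  have hfst : ∀ f : EuclideanSpace ℝ (Fin d) → ℝ,
      ∫ z : EuclideanSpace ℝ (Fin d) × ℝ, f z.1 ∂(ξ.prod ν) = ∫ x, f x ∂ξ := by
    intro f
    rw [integral_fun_fst]; simp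
  have h := measure_sum_sq_ge_le hind hlaw
    (f := fun (j : Fin d) (z : EuclideanSpace ℝ (Fin d) × ℝ) => z.1 j)
    (fun j => by fun_prop) (fun j => (h2 j).comp_fst ν)
    (fun j => by rw [hfst fun x => x j, h0]) hc I hM
  refine (measure_mono fun ω hω => ?_).trans (h.trans (ENNReal.ofReal_le_ofReal ?_))
  · have hω' : M < ‖∑ i ∈ I, c i • (U i ω).1‖ := hω
    have := pow_le_pow_left₀ hM.le hω'.le 2
    rwa [norm_sq_sum_smul] at this
  · simp only [fun j => hfst fun x => x j ^ 2]
    have := sum_integral_sq_le h4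
    gcongr

/-- Tail bound for the Frobenius norm of the centred Gram matrix. -/
theorem measure_gram_le [IsProbabilityMeasure ξ] (hind : iIndepFun U P)
    (hlaw : ∀ i, HasLaw (U i) (ξ.prod ν) P)
    (h4 : ∀ j, MemLp (fun x : EuclideanSpace ℝ (Fin d) => x j) 4 ξ)
    (h0 : ∀ j, ∫ x, x j ∂ξ = 0) (I : Finset (Fin n)) {M : ℝ} (hM : 0 < M) :
    P {ω | M < normF (gram (fun i => (U i ω).1) I - (I.card : ℝ) • covMat ξ)} ≤
      ENNReal.ofReal (n * (d * kappaX ξ) ^ 2 / M ^ 2) := by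
  have hm := fun p : Fin d × Fin d => memLp_two_mul (h4 p.1) (h4 p.2)
  have hmc := fun p : Fin d × Fin d => (hm p).sub (memLp_const (μ := ξ) (covMat ξ p.1 p.2))
  have hfst : ∀ f : EuclideanSpace ℝ (Fin d) → ℝ,
      ∫ z : EuclideanSpace ℝ (Fin d) × ℝ, f z.1 ∂(ξ.prod ν) = ∫ x, f x ∂ξ := by
    intro f
    rw [integral_fun_fst]; simp
  have h := measure_sum_sq_ge_le hind hlaw
    (f := fun (p : Fin d × Fin d) (z : EuclideanSpace ℝ (Fin d) × ℝ) =>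
      z.1 p.1 * z.1 p.2 - covMat ξ p.1 p.2)
    (fun p => by fun_prop) (fun p => (hmc p).comp_fst ν)
    (fun p => by
      rw [hfst fun x => x p.1 * x p.2 - covMat ξ p.1 p.2,
        integral_sub ((hm p).integrable (by norm_num)) (integrable_const _), covMat_apply h0]
      simp)
    (c := fun _ => 1) (fun _ => by simp) I hM
  refine (measure_mono fun ω hω => ?_).trans (h.trans (ENNReal.ofReal_le_ofReal ?_))
  · have hω' : M < normF (gram (fun i => (U i ω).1) I - (I.card : ℝ) • covMat ξ) := hω
    have := pow_le_pow_left₀ hM.le hω'.le 2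
    rw [normF, Real.sq_sqrt (by positivity), ← Fintype.sum_prod_type'] at this
    refine this.trans (le_of_eq (Finset.sum_congr rfl fun p _ => ?_))
    simp [gram]
  · have hle : ∀ p : Fin d × Fin d, ∫ z : EuclideanSpace ℝ (Fin d) × ℝ,
        (z.1 p.1 * z.1 p.2 - covMat ξ p.1 p.2) ^ 2 ∂(ξ.prod ν) ≤
          ∫ x, (x p.1 * x p.2) ^ 2 ∂ξ := by
      intro p
      rw [hfst fun x => (x p.1 * x p.2 - covMat ξ p.1 p.2) ^ 2, covMat_apply h0,
        ← variance_eq_integral (hm p).aemeasurable]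
      exact variance_le_expectation_sq (hm p).aestronglyMeasurable
    have := (Finset.sum_le_sum fun p _ => hle p).trans (sum_integral_mul_sq_le h4)
    gcongr

theorem measure_exists_norm_gt_le [IsProbabilityMeasure ξ]
    {X : Fin n → Ω → EuclideanSpace ℝ (Fin d)}
    (hlaw : ∀ i, HasLaw (X i) ξ P)
    (h4 : ∀ j, MemLp (fun x : EuclideanSpace ℝ (Fin d) => x j) 4 ξ) {M : ℝ} (hM : 0 < M) :
    P {ω | ∃ i, M < ‖X i ω‖} ≤ ENNReal.ofReal (n * (d * kappaX ξ) ^ 2 / M ^ 4) := by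
  have h := measure_exists_lt_le hlaw (f := fun x => ‖x‖ ^ 4) (fun x => by positivity)
    (integrable_norm_pow_four h4) (M := M ^ 4) (by positivity)
  refine (measure_mono fun ω hω => ?_).trans (h.trans (ENNReal.ofReal_le_ofReal ?_))
  · obtain ⟨i, hi⟩ := hω
    exact ⟨i, pow_lt_pow_left₀ hi hM.le (by norm_num)⟩
  · have := integral_norm_pow_four_le h4
    gcongr

end Moments

theorem norm_charFun_sub_le {Ω E : Type*} [MeasurableSpace Ω] [NormedAddCommGroup E]
    [InnerProductSpace ℝ E] [MeasurableSpace E] [BorelSpace E] [SecondCountableTopology E]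
    {P : Measure Ω} [IsProbabilityMeasure P] {T W : Ω → E} (hT : AEMeasurable T P)
    (hW : AEMeasurable W P) (B : Set Ω) {δ : ℝ} (hδ : 0 ≤ δ)
    (hB : ∀ᵐ ω ∂P, ω ∉ B → ‖T ω - W ω‖ ≤ δ) (t : E) :
    ‖charFun (P.map T) t - charFun (P.map W) t‖ ≤ δ * ‖t‖ + 2 * (P B).toReal := by
  have hm : ∀ {V : Ω → E}, AEMeasurable V P →
      AEStronglyMeasurable (fun ω => Complex.exp ((inner ℝ (V ω) t : ℝ) * Complex.I)) P := by
    intro V hV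
    have : AEMeasurable (fun ω => (inner ℝ (V ω) t : ℝ)) P := hV.inner_const
    exact (by fun_prop : AEMeasurable (fun ω => Complex.exp ((inner ℝ (V ω) t : ℝ) *
      Complex.I)) P).aestronglyMeasurable
  have hi : ∀ {V : Ω → E}, AEMeasurable V P →
      Integrable (fun ω => Complex.exp ((inner ℝ (V ω) t : ℝ) * Complex.I)) P := fun hV =>
    Integrable.of_bound (C := 1) (hm hV)
      (Eventually.of_forall fun ω => (Complex.norm_exp_ofReal_mul_I _).le)
  have hc : ∀ {V : Ω → E}, AEMeasurable V P → charFun (P.map V) t =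
      ∫ ω, Complex.exp ((inner ℝ (V ω) t : ℝ) * Complex.I) ∂P := by
    intro V hV
    rw [charFun_apply, integral_map hV (by fun_prop)]
  rw [hc hT, hc hW, ← integral_sub (hi hT) (hi hW)]
  set B' := toMeasurable P B
  have hB' : MeasurableSet B' := measurableSet_toMeasurable P B
  have hint : Integrable (fun ω => δ * ‖t‖ + B'.indicator (fun _ => (2 : ℝ)) ω) P :=
    (integrable_const _).add ((integrable_const _).indicator hB')
  have hle : ∀ᵐ ω ∂P, ‖Complex.exp ((inner ℝ (T ω) t : ℝ) * Complex.I) -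
      Complex.exp ((inner ℝ (W ω) t : ℝ) * Complex.I)‖ ≤
        δ * ‖t‖ + B'.indicator (fun _ => (2 : ℝ)) ω := by
    filter_upwards [hB] with ω hω
    by_cases h : ω ∈ B'
    · rw [Set.indicator_of_mem h]
      have h1 := norm_sub_le (Complex.exp ((inner ℝ (T ω) t : ℝ) * Complex.I))
        (Complex.exp ((inner ℝ (W ω) t : ℝ) * Complex.I))
      rw [Complex.norm_exp_ofReal_mul_I, Complex.norm_exp_ofReal_mul_I] at h1
      have : 0 ≤ δ * ‖t‖ := by positivity
      linarith
    · rw [Set.indicator_of_notMem h, add_zero]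
      have h1 := hω fun hb => h (subset_toMeasurable P B hb)
      have h2 : Complex.exp ((inner ℝ (T ω) t : ℝ) * Complex.I) -
          Complex.exp ((inner ℝ (W ω) t : ℝ) * Complex.I) =
          Complex.exp ((inner ℝ (W ω) t : ℝ) * Complex.I) *
            (Complex.exp (Complex.I * (inner ℝ (T ω - W ω) t : ℝ)) - 1) := by
        rw [mul_sub, ← Complex.exp_add, inner_sub_left]
        push_cast
        ring_nf
      rw [h2, norm_mul, Complex.norm_exp_ofReal_mul_I, one_mul]
      refine Real.norm_exp_I_mul_ofReal_sub_one_le.trans ?_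
      exact (norm_inner_le_norm _ _).trans (mul_le_mul_of_nonneg_right h1 (norm_nonneg _))
  refine (norm_integral_le_integral_norm _).trans
    ((integral_mono_ae ((hi hT).sub (hi hW)).norm hint hle).trans (le_of_eq ?_))
  rw [integral_add (integrable_const _) ((integrable_const _).indicator hB'),
    integral_indicator hB', setIntegral_const, measureReal_def, measure_toMeasurable]
  simp [mul_comm]

theorem measurable_leastSquaresOn {n d : ℕ} (I : Finset (Fin n)) :
    Measurable fun p : (Fin n → EuclideanSpace ℝ (Fin d)) × (Fin n → ℝ) =>
      leastSquaresOn p.1 p.2 I := by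
  have he : ∀ p : (Fin n → EuclideanSpace ℝ (Fin d)) × (Fin n → ℝ),
      leastSquaresOn p.1 p.2 I = WithLp.toLp 2 ((gram p.1 I).det⁻¹ •
        ((gram p.1 I).adjugate *ᵥ (∑ i ∈ I, p.2 i • p.1 i : EuclideanSpace ℝ (Fin d)).ofLp)) := by
    intro p
    rw [leastSquaresOn, designOn_transpose_mul_self, designOn_transpose_mulVec, Matrix.inv_def,
      Ring.inverse_eq_inv', Matrix.smul_mulVec]
  have hg : Continuous fun p : (Fin n → EuclideanSpace ℝ (Fin d)) × (Fin n → ℝ) =>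
      gram p.1 I := by
    refine continuous_matrix fun j k => ?_
    simp only [gram, Matrix.of_apply]
    fun_prop
  simp only [he]
  have h1 : Measurable fun p : (Fin n → EuclideanSpace ℝ (Fin d)) × (Fin n → ℝ) =>
      (gram p.1 I).det⁻¹ := hg.matrix_det.measurable.inv
  have h2 : Measurable fun p : (Fin n → EuclideanSpace ℝ (Fin d)) × (Fin n → ℝ) =>
      (gram p.1 I).adjugate *ᵥ (∑ i ∈ I, p.2 i • p.1 i : EuclideanSpace ℝ (Fin d)).ofLp :=
    (hg.matrix_adjugate.matrix_mulVec (by fun_prop)).measurable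
  exact (PiLp.continuous_toLp 2 _).measurable.comp (h1.smul h2)

theorem measurable_twoStep {n d : ℕ} :
    Measurable fun p : ((Fin n → EuclideanSpace ℝ (Fin d)) × (Fin n → ℝ)) × (Fin n → ℝ) =>
      twoStep p.1.1 p.1.2 p.2 := by
  have he : ∀ p : ((Fin n → EuclideanSpace ℝ (Fin d)) × (Fin n → ℝ)) × (Fin n → ℝ),
      twoStep p.1.1 p.1.2 p.2 = ∑ I : Finset (Fin n),
        Set.indicator {p : ((Fin n → EuclideanSpace ℝ (Fin d)) × (Fin n → ℝ)) × (Fin n → ℝ) |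
          zeroIndices p.2 = I} (fun p => leastSquaresOn p.1.1 p.1.2 I) p := by
    intro p
    rw [Finset.sum_eq_single (zeroIndices p.2)]
    · rw [Set.indicator_of_mem (by rfl)]; rfl
    · intro I _ hI
      exact Set.indicator_of_notMem (fun h => hI h.symm) _
    · simp
  simp only [he]
  refine Finset.measurable_fun_sum _ fun I _ => ?_
  refine ((measurable_leastSquaresOn I).comp measurable_fst).indicator ?_
  have hs : {p : ((Fin n → EuclideanSpace ℝ (Fin d)) × (Fin n → ℝ)) × (Fin n → ℝ) |
      zeroIndices p.2 = I} = ⋂ i : Fin n, {p | p.2 i = 0 ↔ i ∈ I} := by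
    ext p
    simp [zeroIndices, Finset.ext_iff]
  rw [hs]
  refine MeasurableSet.iInter fun i => ?_
  have h0 : MeasurableSet {p : ((Fin n → EuclideanSpace ℝ (Fin d)) × (Fin n → ℝ)) ×
      (Fin n → ℝ) | p.2 i = 0} := measurableSet_eq_fun (by fun_prop) measurable_const
  by_cases hi : i ∈ I
  · simpa [hi] using h0
  · refine h0.compl.congr ?_
    ext p
    simp [hi]

theorem card_smallIdx (n s : ℕ) : (smallIdx n s).card = n - s := by
  have h : (smallIdx n s).map Fin.valEmbedding = Finset.Ico s n := by
    ext i
    simp only [smallIdx, Finset.mem_map, Finset.mem_filter, Finset.mem_univ, true_and,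
      Fin.valEmbedding_apply, Finset.mem_Ico]
    exact ⟨fun ⟨a, ha, hai⟩ => hai ▸ ⟨ha, a.2⟩, fun ⟨h1, h2⟩ => ⟨⟨i, h2⟩, h1, rfl⟩⟩
  rw [← Finset.card_map, h, Nat.card_Ico]

theorem norm_sum_bounded_le {n d s₁ s₂ : ℕ} {x : Fin n → EuclideanSpace ℝ (Fin d)}
    {mu : Fin n → ℝ} {γ k : ℝ} (hγ : 0 ≤ γ) (hk : 0 ≤ k) (hx : ∀ i, ‖x i‖ ≤ k)
    (hbdd : ∀ i : Fin n, s₁ ≤ i.val → |mu i| ≤ γ)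
    (hzero : ∀ i : Fin n, s₁ + s₂ ≤ i.val → mu i = 0) :
    ‖∑ i ∈ smallIdx n s₁, mu i • x i‖ ≤ s₂ * γ * k := by
  have hfil : ∑ i ∈ smallIdx n s₁, mu i • x i =
      ∑ i ∈ (smallIdx n s₁).filter (fun i => i.val < s₁ + s₂), mu i • x i := by
    rw [Finset.sum_filter]
    refine Finset.sum_congr rfl fun i _ => ?_
    split_ifs with h
    · rfl
    · rw [hzero i (not_lt.1 h), zero_smul]
  have hcard : ((smallIdx n s₁).filter (fun i => i.val < s₁ + s₂)).card ≤ s₂ := by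
    have h : ((smallIdx n s₁).filter (fun i => i.val < s₁ + s₂)).map Fin.valEmbedding ⊆
        Finset.Ico s₁ (s₁ + s₂) := by
      intro i hi
      obtain ⟨a, ha, rfl⟩ := Finset.mem_map.1 hi
      simp only [smallIdx, Finset.mem_filter, Finset.mem_univ, true_and] at ha
      exact Finset.mem_Ico.2 ha
    have := Finset.card_le_card h
    rwa [Finset.card_map, Nat.card_Ico, Nat.add_sub_cancel_left] at this
  rw [hfil]
  refine (norm_sum_le _ _).trans ((Finset.sum_le_card_nsmul _ _ (γ * k) fun i hi => ?_).trans ?_)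
  · simp only [smallIdx, Finset.mem_filter, Finset.mem_univ, true_and] at hi
    rw [norm_smul, Real.norm_eq_abs]
    exact mul_le_mul (hbdd i hi.1) (hx i) (norm_nonneg _) hγ
  · rw [nsmul_eq_mul, mul_assoc]
    have : (((smallIdx n s₁).filter (fun i => i.val < s₁ + s₂)).card : ℝ) ≤ s₂ := by
      exact_mod_cast hcard
    gcongr

/-- The linear part `√n A (m Σ)⁻¹ ∑ eᵢ xᵢ` of the rescaled error of the two-step estimator, where
the sum is over the `m` observations without a large incidental parameter. -/
@[irreducible] noncomputable def linearPart {n d q : ℕ} (s : ℕ) (A : Matrix (Fin q) (Fin d) ℝ)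
    (M : Matrix (Fin d) (Fin d) ℝ) (x : Fin n → EuclideanSpace ℝ (Fin d)) (e : Fin n → ℝ) :
    EuclideanSpace ℝ (Fin q) :=
  WithLp.toLp 2 (Real.sqrt n • (A *ᵥ (((n - s : ℕ) : ℝ)⁻¹ •
    (M⁻¹ *ᵥ (∑ i ∈ smallIdx n s, e i • x i : EuclideanSpace ℝ (Fin d)).ofLp))))

/-- On a favourable sample, the rescaled error of the two-step estimator is close to its linear
part. -/
theorem norm_twoStep_sub_linearPart_le {n d q s₁ s₂ : ℕ}
    {x : Fin n → EuclideanSpace ℝ (Fin d)}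
    {mu e mh : Fin n → ℝ} {β βh : EuclideanSpace ℝ (Fin d)} {l k γ α c η M₁ M₂ C : ℝ}
    {M : Matrix (Fin d) (Fin d) ℝ} {A : Matrix (Fin q) (Fin d) ℝ}
    (hα : 2 < α) (hγ : 0 < γ) (hl : α * γ ≤ l) (hk : 0 < k)
    (hx : ∀ i, ‖x i‖ ≤ k) (he : ∀ i, |e i| ≤ γ)
    (hlarge : ∀ i : Fin n, i.val < s₁ → 3 * l ≤ |mu i|)
    (hbdd : ∀ i : Fin n, s₁ ≤ i.val → |mu i| ≤ γ)
    (hzero : ∀ i : Fin n, s₁ + s₂ ≤ i.val → mu i = 0)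
    (hM : Coercive c M) (hc : 0 < c) (hm : 0 < n - s₁)
    (hgram : normF (gram x (smallIdx n s₁) - ((n - s₁ : ℕ) : ℝ) • M) ≤ η)
    (hη : η ≤ ((n - s₁ : ℕ) : ℝ) * c / 2)
    (hnoise : ‖∑ i ∈ smallIdx n s₁, e i • x i‖ ≤ M₁)
    (hsigned : ‖∑ i ∈ largeIdx n s₁, sgn (mu i) • x i‖ ≤ M₂)
    (hrate : 2 * (M₁ + s₂ * γ * k + l * M₂) <
      ((n - s₁ : ℕ) : ℝ) * c / 2 * ((1 - 2 / α) / 2 * l / k))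
    (hA : normF A ≤ C)
    (hmin : IsMinOn (penalizedLoss l x (response mu x β e)) Set.univ (mh, βh)) :
    ‖WithLp.toLp 2 (Real.sqrt n • (A *ᵥ (twoStep x (response mu x β e) mh - β).ofLp)) -
        linearPart s₁ A M x e‖ ≤
      Real.sqrt n * (C * ((s₂ * γ * k + η * (M₁ / (((n - s₁ : ℕ) : ℝ) * c))) /
        (((n - s₁ : ℕ) : ℝ) * c / 2))) := by
  set m : ℝ := ((n - s₁ : ℕ) : ℝ) with hm'
  have hm0 : 0 < m := by rw [hm']; exact_mod_cast hm
  have hl0 : 0 < l := lt_of_lt_of_le (by positivity) hl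
  have hα3 : 2 / α < 1 := (div_lt_one (by linarith)).2 hα
  have hR : 0 < (1 - 2 / α) / 2 * l / k := by
    have : 0 < 1 - 2 / α := by linarith
    positivity
  have hη0 : 0 ≤ η := (normF_nonneg _).trans hgram
  have hcoer : Coercive (m * c / 2) (gram x (smallIdx n s₁)) :=
    hM.of_normF_sub_le hm0.le hgram (by linarith)
  have hbias := norm_sum_bounded_le (s₂ := s₂) hγ.le hk.le hx hbdd hzero
  have hzi : zeroIndices mh = smallIdx n s₁ := by
    refine zeroIndices_eq_smallIdx hα hγ hl hR (le_of_eq ?_) hx he hlarge hbdd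
      (b := m * c / 2) (fun v => ?_) ?_ hmin
    · field_simp
    · rw [← dotProduct_gram_mulVec]; exact hcoer v
    · refine lt_of_le_of_lt ?_ hrate
      have h1 : ∑ i ∈ smallIdx n s₁, (mu i + e i) • x i =
          ∑ i ∈ smallIdx n s₁, mu i • x i + ∑ i ∈ smallIdx n s₁, e i • x i := by
        rw [← Finset.sum_add_distrib]
        exact Finset.sum_congr rfl fun i _ => add_smul _ _ _
      have h2 : ‖l • ∑ i ∈ largeIdx n s₁, sgn (mu i) • x i‖ ≤ l * M₂ := by
        rw [norm_smul, Real.norm_eq_abs, abs_of_pos hl0]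
        gcongr
      have h3 := norm_add_le (∑ i ∈ smallIdx n s₁, (mu i + e i) • x i)
        (l • ∑ i ∈ largeIdx n s₁, sgn (mu i) • x i)
      have h4 := norm_add_le (∑ i ∈ smallIdx n s₁, mu i • x i)
        (∑ i ∈ smallIdx n s₁, e i • x i)
      rw [← h1] at h4
      linarith
  have hkey := norm_leastSquaresOn_sub_sub_le (mu := mu) (e := e) (β := β) hM hc hm0 hgram
    (c' := m * c / 2) (by positivity) (by linarith)
  have heq : WithLp.toLp 2 (Real.sqrt n • (A *ᵥ (twoStep x (response mu x β e) mh - β).ofLp)) -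
        linearPart s₁ A M x e =
      Real.sqrt n • WithLp.toLp 2 (A *ᵥ
        ((leastSquaresOn x (response mu x β e) (smallIdx n s₁) - β) - WithLp.toLp 2 (m⁻¹ •
        (M⁻¹ *ᵥ (∑ i ∈ smallIdx n s₁, e i • x i : EuclideanSpace ℝ (Fin d)).ofLp)) :
          EuclideanSpace ℝ (Fin d)).ofLp) := by
    rw [twoStep, hzi, linearPart, WithLp.ofLp_sub _ (_ - _) _, Matrix.mulVec_sub]
    rw [WithLp.toLp_sub, smul_sub, WithLp.toLp_smul, WithLp.toLp_smul]
  rw [heq, norm_smul, Real.norm_eq_abs, abs_of_nonneg (Real.sqrt_nonneg _)]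
  refine mul_le_mul_of_nonneg_left ((norm_mulVec_le _ _).trans ?_) (Real.sqrt_nonneg _)
  refine mul_le_mul hA (hkey.trans ?_) (norm_nonneg _) ((normF_nonneg _).trans hA)
  gcongr

theorem inner_linearPart {n d q s : ℕ} {A : Matrix (Fin q) (Fin d) ℝ}
    {M : Matrix (Fin d) (Fin d) ℝ} (hM : M.IsSymm) (x : Fin n → EuclideanSpace ℝ (Fin d))
    (e : Fin n → ℝ) (t : EuclideanSpace ℝ (Fin q)) :
    inner ℝ (linearPart s A M x e) t = ∑ i ∈ smallIdx n s,
      Real.sqrt n / ((n - s : ℕ) : ℝ) *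
        (inner ℝ (WithLp.toLp 2 (M⁻¹ *ᵥ (Aᵀ *ᵥ t.ofLp)) : EuclideanSpace ℝ (Fin d)) (x i) *
          e i) := by
  have hMi : M⁻¹ᵀ = M⁻¹ := by rw [Matrix.transpose_nonsing_inv, hM.eq]
  have h1 : ∀ v : Fin d → ℝ, (A *ᵥ (M⁻¹ *ᵥ v)) ⬝ᵥ t.ofLp = (M⁻¹ *ᵥ (Aᵀ *ᵥ t.ofLp)) ⬝ᵥ v := by
    intro v
    rw [dotProduct_comm, Matrix.dotProduct_mulVec, Matrix.dotProduct_mulVec,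
      ← Matrix.mulVec_transpose, ← Matrix.mulVec_transpose, hMi]
  rw [inner_eq_dotProduct, linearPart]
  simp only
  rw [Matrix.mulVec_smul, smul_dotProduct, smul_dotProduct, h1, ← Finset.mul_sum,
    smul_eq_mul, smul_eq_mul, ← mul_assoc, div_eq_mul_inv]
  congr 1
  simp only [inner_eq_dotProduct, WithLp.ofLp_sum, WithLp.ofLp_smul, dotProduct_sum,
    dotProduct_smul, smul_eq_mul]
  exact Finset.sum_congr rfl fun i _ => mul_comm _ _

theorem measurable_linearPart {n d q : ℕ} (s : ℕ) (A : Matrix (Fin q) (Fin d) ℝ)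
    (M : Matrix (Fin d) (Fin d) ℝ) :
    Measurable fun p : (Fin n → EuclideanSpace ℝ (Fin d)) × (Fin n → ℝ) =>
      linearPart s A M p.1 p.2 := by
  have h1 : Continuous fun p : (Fin n → EuclideanSpace ℝ (Fin d)) × (Fin n → ℝ) =>
      M⁻¹ *ᵥ (∑ i ∈ smallIdx n s, p.2 i • p.1 i : EuclideanSpace ℝ (Fin d)).ofLp :=
    continuous_const.matrix_mulVec (by fun_prop)
  have h2 : Continuous fun p : (Fin n → EuclideanSpace ℝ (Fin d)) × (Fin n → ℝ) =>
      A *ᵥ (((n - s : ℕ) : ℝ)⁻¹ •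
        (M⁻¹ *ᵥ (∑ i ∈ smallIdx n s, p.2 i • p.1 i : EuclideanSpace ℝ (Fin d)).ofLp)) :=
    continuous_const.matrix_mulVec (h1.fun_const_smul _)
  unfold linearPart
  exact ((PiLp.continuous_toLp 2 _).comp (h2.fun_const_smul (Real.sqrt n))).measurable

/-- The characteristic function of the linear part. -/
theorem charFun_linearPart {n d q s : ℕ} {Ω : Type*} [MeasurableSpace Ω] {P : Measure Ω}
    [IsProbabilityMeasure P] {ξ : Measure (EuclideanSpace ℝ (Fin d))} {ν : Measure ℝ}
    {U : Fin n → Ω → EuclideanSpace ℝ (Fin d) × ℝ} (hind : iIndepFun U P)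
    (hlaw : ∀ i, HasLaw (U i) (ξ.prod ν) P) {A : Matrix (Fin q) (Fin d) ℝ}
    {M : Matrix (Fin d) (Fin d) ℝ} (hM : M.IsSymm) (t : EuclideanSpace ℝ (Fin q)) :
    charFun (P.map fun ω => linearPart s A M (fun i => (U i ω).1) fun i => (U i ω).2) t =
      (∫ z : EuclideanSpace ℝ (Fin d) × ℝ, Complex.exp (((Real.sqrt n / ((n - s : ℕ) : ℝ) *
        (inner ℝ (WithLp.toLp 2 (M⁻¹ *ᵥ (Aᵀ *ᵥ t.ofLp)) : EuclideanSpace ℝ (Fin d)) z.1 *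
          z.2) : ℝ) : ℂ) * Complex.I) ∂(ξ.prod ν)) ^ (n - s) := by
  have hUm : AEMeasurable (fun ω => ((fun i => (U i ω).1), fun i => (U i ω).2)) P :=
    (aemeasurable_pi_lambda _ fun i => (hlaw i).aemeasurable.fst).prodMk
      (aemeasurable_pi_lambda _ fun i => (hlaw i).aemeasurable.snd)
  have hL : AEMeasurable (fun ω => linearPart s A M (fun i => (U i ω).1) fun i => (U i ω).2) P :=
    Measurable.comp_aemeasurable (g := fun p : (Fin n → EuclideanSpace ℝ (Fin d)) × (Fin n → ℝ) =>
      linearPart s A M p.1 p.2) (measurable_linearPart s A M) hUm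
  rw [charFun_apply, integral_map hL (by fun_prop)]
  have hg : Measurable fun z : EuclideanSpace ℝ (Fin d) × ℝ => Real.sqrt n / ((n - s : ℕ) : ℝ) *
      (inner ℝ (WithLp.toLp 2 (M⁻¹ *ᵥ (Aᵀ *ᵥ t.ofLp)) : EuclideanSpace ℝ (Fin d)) z.1 *
        z.2) := by fun_prop
  have hpow := integral_exp_sum_eq_pow hind hlaw hg (smallIdx n s)
  rw [card_smallIdx] at hpow
  rw [← hpow]
  simp only [inner_linearPart hM]

theorem detection_rate_lt {g h κ k l γ s a c m : ℝ} (hg : 1 ≤ g) (hh : 1 ≤ h) (hc : 0 < c)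
    (ha : 0 < a) (hγ : 0 < γ) (hs : 0 ≤ s) (hk : 0 < k) (hkκ : k ≤ κ) (hkg : k ≤ g * h ^ 5)
    (hκl : h ^ 4 * κ ≤ l) (hsκ : s * γ * κ ≤ g ^ 2 / h ^ 4) (hm : g ^ 4 / 2 ≤ m)
    (hθ : 6 * (h ^ 10 / g) < c * a / 4) :
    2 * (g ^ 2 * h ^ 5 + s * γ * k + l * (g ^ 2 * h ^ 5)) < m * c / 2 * (a * l / k) := by
  have hκ0 : 0 < κ := hk.trans_le hkκ
  have hκl' : κ ≤ l := by
    have : 1 * κ ≤ h ^ 4 * κ := mul_le_mul_of_nonneg_right (one_le_pow₀ hh) hκ0.le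
    linarith
  have hl : 0 < l := hκ0.trans_le hκl'
  have hg0 : 0 < g := by linarith
  have hh0 : 0 < h := by linarith
  have hG : g ^ 2 ≤ g ^ 3 := pow_le_pow_right₀ hg (by norm_num)
  have hH : h ^ 5 ≤ h ^ 10 := pow_le_pow_right₀ hh (by norm_num)
  have hH1 : 1 ≤ h ^ 10 := one_le_pow₀ hh
  have e1 : k * (g ^ 2 * h ^ 5) ≤ l * (g ^ 3 * h ^ 10) := by
    have := hkκ.trans hκl'
    gcongr
  have e2 : k * (s * γ * k) ≤ l * (g ^ 3 * h ^ 10) := by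
    have h1 : s * γ * k ≤ s * γ * κ := by gcongr
    have h2 : g ^ 2 / h ^ 4 ≤ g ^ 2 := div_le_self (by positivity) (one_le_pow₀ hh)
    have h3 : g ^ 2 * 1 ≤ g ^ 3 * h ^ 10 := by gcongr
    have h4 : s * γ * k ≤ g ^ 3 * h ^ 10 := by linarith
    exact mul_le_mul (hkκ.trans hκl') h4 (by positivity) hl.le
  have e3 : k * (l * (g ^ 2 * h ^ 5)) ≤ l * (g ^ 3 * h ^ 10) := by
    calc k * (l * (g ^ 2 * h ^ 5)) ≤ (g * h ^ 5) * (l * (g ^ 2 * h ^ 5)) := by gcongr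
      _ = _ := by ring
  have e4 : 6 * h ^ 10 < c * a / 4 * g := by
    rw [← mul_div_assoc, div_lt_iff₀ hg0] at hθ
    exact hθ
  have e5 : l * g ^ 3 * (6 * h ^ 10) < l * g ^ 3 * (c * a / 4 * g) := by gcongr
  have e6 : g ^ 4 / 2 * (c * a * l) ≤ m * (c * a * l) := by gcongr
  have e7 : m * c / 2 * (a * l / k) = (m * (c * a * l) / 2) / k := by ring
  rw [e7, lt_div_iff₀ hk]
  nlinarith

theorem linearization_rate_le {g h κ k γ s c m C : ℝ} (hg : 1 ≤ g) (hh : 1 ≤ h) (hc : 0 < c)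
    (hγ : 0 < γ) (hs : 0 ≤ s) (hC : 0 ≤ C) (hkκ : k ≤ κ)
    (hsκ : s * γ * κ ≤ g ^ 2 / h ^ 4) (hm : g ^ 4 / 2 ≤ m) :
    g ^ 2 * (C * ((s * γ * k + g ^ 2 * h ^ 9 * (g ^ 2 * h ^ 5 / (m * c))) / (m * c / 2))) ≤
      C * (4 / c) * (1 / h ^ 4 + 2 / c * (h ^ 10 / g) ^ 2) := by
  have hg0 : 0 < g := by linarith
  have hh0 : 0 < h := by linarith
  have h1 : s * γ * k ≤ g ^ 2 / h ^ 4 := le_trans (by gcongr) hsκ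
  have hb : g ^ 2 / h ^ 4 + g ^ 2 * h ^ 9 * (g ^ 2 * h ^ 5 / (g ^ 4 / 2 * c)) ≥ 0 := by positivity
  calc _ ≤ g ^ 2 * (C * ((g ^ 2 / h ^ 4 + g ^ 2 * h ^ 9 * (g ^ 2 * h ^ 5 / (g ^ 4 / 2 * c))) /
        (g ^ 4 / 2 * c / 2))) := by gcongr
    _ = C * (4 / c) * (1 / h ^ 4 + 2 / c * (h ^ 14 / g ^ 2)) := by field_simp; ring
    _ ≤ C * (4 / c) * (1 / h ^ 4 + 2 / c * (h ^ 20 / g ^ 2)) := by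
        have : h ^ 14 ≤ h ^ 20 := pow_le_pow_right₀ hh (by norm_num)
        gcongr
    _ = _ := by ring

theorem tendsto_zero_of_le_ofReal {u : ℕ → ENNReal} {f : ℕ → ℝ}
    (hu : ∀ᶠ n in atTop, u n ≤ ENNReal.ofReal (f n)) (hf : Tendsto f atTop (𝓝 0)) :
    Tendsto u atTop (𝓝 0) := by
  have h := ENNReal.tendsto_ofReal hf
  rw [ENNReal.ofReal_zero] at h
  exact tendsto_of_tendsto_of_tendsto_of_le_of_le' tendsto_const_nhds h
    (Eventually.of_forall fun _ => zero_le) hu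

/-- The eighth root of the dimension and the fourth root of the sample size. -/
theorem exists_scales {d : ℕ → ℕ} (hd : Tendsto d atTop atTop)
    (hrate : (fun n => (d n : ℝ) ^ 5 * Real.log (d n)) =o[atTop] fun n => (n : ℝ)) :
    ∃ g h : ℕ → ℝ, (∀ n : ℕ, g n ^ 4 = n) ∧ (∀ n, h n ^ 8 = d n) ∧
      (∀ n : ℕ, Real.sqrt n = g n ^ 2) ∧
      (∀ n, Real.sqrt (d n) = h n ^ 4) ∧ (∀ᶠ n in atTop, 1 ≤ g n) ∧ (∀ᶠ n in atTop, 1 ≤ h n) ∧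
      Tendsto g atTop atTop ∧ Tendsto h atTop atTop ∧
      Tendsto (fun n => h n ^ 10 / g n) atTop (𝓝 0) := by
  have hs2 : ∀ x : ℝ, 0 ≤ x → √(√x) ^ 4 = x := fun x hx => by
    rw [show √(√x) ^ 4 = (√(√x) ^ 2) ^ 2 by ring, Real.sq_sqrt (Real.sqrt_nonneg _),
      Real.sq_sqrt hx]
  have hdR : Tendsto (fun n => (d n : ℝ)) atTop atTop := tendsto_natCast_atTop_atTop.comp hd
  have hg : Tendsto (fun n : ℕ => √(√(n : ℝ))) atTop atTop :=
    Real.tendsto_sqrt_atTop.comp (Real.tendsto_sqrt_atTop.comp tendsto_natCast_atTop_atTop)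
  have hh : Tendsto (fun n : ℕ => √(√(√(d n : ℝ)))) atTop atTop :=
    Real.tendsto_sqrt_atTop.comp (Real.tendsto_sqrt_atTop.comp (Real.tendsto_sqrt_atTop.comp hdR))
  have h8 : ∀ n, √(√(√(d n : ℝ))) ^ 4 = √(d n) := fun n => hs2 _ (Real.sqrt_nonneg _)
  have h8' : ∀ n, √(√(√(d n : ℝ))) ^ 8 = d n := fun n => by
    rw [show √(√(√(d n : ℝ))) ^ 8 = (√(√(√(d n : ℝ))) ^ 4) ^ 2 by ring, h8,
      Real.sq_sqrt (Nat.cast_nonneg _)]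
  refine ⟨fun n => √(√(n : ℝ)), fun n => √(√(√(d n : ℝ))), fun n => hs2 _ (Nat.cast_nonneg _),
    h8', fun n => (Real.sq_sqrt (Real.sqrt_nonneg _)).symm, fun n => (h8 n).symm,
    hg.eventually_ge_atTop 1, hh.eventually_ge_atTop 1, hg, hh, ?_⟩
  have hlog : Tendsto (fun n => Real.log (d n)) atTop atTop := Real.tendsto_log_atTop.comp hdR
  have hz : Tendsto (fun n => (d n : ℝ) ^ 5 / n) atTop (𝓝 0) := by
    refine tendsto_of_tendsto_of_tendsto_of_le_of_le' tendsto_const_nhds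
      hrate.tendsto_div_nhds_zero (Eventually.of_forall fun n => by positivity) ?_
    filter_upwards [hlog.eventually_ge_atTop 1] with n hn
    exact div_le_div_of_nonneg_right (le_mul_of_one_le_right (by positivity) hn)
      (Nat.cast_nonneg _)
  have h4 := (Real.continuous_sqrt.tendsto _).comp ((Real.continuous_sqrt.tendsto _).comp hz)
  simp only [Real.sqrt_zero] at h4
  refine h4.congr fun n => ?_
  have e : (d n : ℝ) ^ 5 / n = (((√(√(√(d n : ℝ)))) ^ 10 / √(√(n : ℝ))) ^ 2) ^ 2 := by
    have e1 : (d n : ℝ) ^ 5 = (√(√(√(d n : ℝ)))) ^ 40 := by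
      rw [show (40 : ℕ) = 8 * 5 from rfl, pow_mul, h8']
    rw [e1, ← pow_mul, div_pow, show (2 * 2) = 4 from rfl, hs2 _ (Nat.cast_nonneg _), ← pow_mul]
  have hp : 0 ≤ (√(√(√(d n : ℝ)))) ^ 10 / √(√(n : ℝ)) := by positivity
  simp only [Function.comp_apply]
  rw [e, Real.sqrt_sq (by positivity), Real.sqrt_sq hp]

theorem tendsto_dotProduct_mulVec {q : ℕ} {M : ℕ → Matrix (Fin q) (Fin q) ℝ}
    {G : Matrix (Fin q) (Fin q) ℝ} (h : Tendsto (fun n => normF (M n - G)) atTop (𝓝 0))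
    (t : EuclideanSpace ℝ (Fin q)) :
    Tendsto (fun n => t.ofLp ⬝ᵥ M n *ᵥ t.ofLp) atTop (𝓝 (t.ofLp ⬝ᵥ G *ᵥ t.ofLp)) := by
  rw [← tendsto_sub_nhds_zero_iff]
  refine squeeze_zero_norm (fun n => ?_) (by simpa using h.mul_const (‖t‖ ^ 2))
  rw [← dotProduct_sub, ← Matrix.sub_mulVec]
  exact abs_dotProduct_mulVec_le _ _

theorem posSemidef_of_tendsto {q : ℕ} {M : ℕ → Matrix (Fin q) (Fin q) ℝ}
    {G : Matrix (Fin q) (Fin q) ℝ} (hG : G.IsSymm)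
    (h : Tendsto (fun n => normF (M n - G)) atTop (𝓝 0))
    (hM : ∀ n, ∀ t : Fin q → ℝ, 0 ≤ t ⬝ᵥ M n *ᵥ t) : G.PosSemidef := by
  refine Matrix.PosSemidef.of_dotProduct_mulVec_nonneg ?_ fun t => ?_
  · rw [Matrix.IsHermitian, Matrix.conjTranspose_eq_transpose_of_trivial]; exact hG
  · rw [star_trivial]
    exact ge_of_tendsto' (tendsto_dotProduct_mulVec h (WithLp.toLp 2 t)) fun n => hM n t

/-- Asymptotic normality of the linear part, in terms of characteristic functions. -/
theorem tendsto_charFun_linearPart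
    {Ω : ℕ → Type*} [∀ n, MeasurableSpace (Ω n)]
    {P : (n : ℕ) → Measure (Ω n)} [∀ n, IsProbabilityMeasure (P n)]
    {d : ℕ → ℕ} {ξ : (n : ℕ) → Measure (EuclideanSpace ℝ (Fin (d n)))}
    [∀ n, IsProbabilityMeasure (ξ n)] {ν : Measure ℝ} [IsProbabilityMeasure ν]
    {U : (n : ℕ) → Fin n → Ω n → EuclideanSpace ℝ (Fin (d n)) × ℝ}
    (hind : ∀ n, iIndepFun (U n) (P n)) (hlaw : ∀ n i, HasLaw (U n i) ((ξ n).prod ν) (P n))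
    (hX4 : ∀ n j, MemLp (fun x : EuclideanSpace ℝ (Fin (d n)) => x j) 4 (ξ n))
    (hX0 : ∀ n j, ∫ x, x j ∂(ξ n) = 0)
    (hcov : ∀ n, (covMat (ξ n)).PosDef)
    (hν : MemLp id 2 ν) (hν0 : ∫ x, x ∂ν = 0) {s : ℕ → ℕ} (hsn : ∀ n, s n ≤ n)
    (hs : (fun n => (s n : ℝ)) =o[atTop] fun n => (n : ℝ))
    (hd : Tendsto d atTop atTop)
    (hdn : Tendsto (fun n : ℕ => (d n : ℝ) / Real.sqrt n) atTop (𝓝 0))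
    {c K C : ℝ} (hc : 0 < c) (hcoer : ∀ᶠ n in atTop, Coercive c (covMat (ξ n)))
    (hK : ∀ n, |kappaX (ξ n)| ≤ K)
    {q : ℕ} {A : (n : ℕ) → Matrix (Fin q) (Fin (d n)) ℝ} {G : Matrix (Fin q) (Fin q) ℝ}
    (hA : ∀ n, normF (A n) ≤ C)
    (hG : Tendsto (fun n => normF (A n * (covMat (ξ n))⁻¹ * (A n)ᵀ - G)) atTop (𝓝 0))
    (t : EuclideanSpace ℝ (Fin q)) :
    Tendsto (fun n => charFun ((P n).map fun ω => linearPart (s n) (A n) (covMat (ξ n))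
      (fun i => (U n i ω).1) fun i => (U n i ω).2) t) atTop
      (𝓝 (Complex.exp ((-((∫ y, y ^ 2 ∂ν) * (t.ofLp ⬝ᵥ G *ᵥ t.ofLp)) / 2 : ℝ) : ℂ))) := by
  have hsymm : ∀ n, (covMat (ξ n)).IsSymm := fun n => by
    have := (hcov n).isHermitian
    rwa [Matrix.IsHermitian, Matrix.conjTranspose_eq_transpose_of_trivial] at this
  have hX2 : ∀ n j, MemLp (fun x : EuclideanSpace ℝ (Fin (d n)) => x j) 2 (ξ n) :=
    fun n j => (hX4 n j).mono_exponent (by norm_num)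
  simp_rw [fun n => charFun_linearPart (hind n) (hlaw n) (s := s n) (A := A n) (hsymm n) t]
  set a : (n : ℕ) → EuclideanSpace ℝ (Fin (d n)) := fun n =>
    WithLp.toLp 2 ((covMat (ξ n))⁻¹ *ᵥ ((A n)ᵀ *ᵥ t.ofLp)) with ha
  set τ : ℕ → ℝ := fun n => Real.sqrt n / ((n - s n : ℕ) : ℝ) with hτ
  have hcova : ∀ n, covMat (ξ n) *ᵥ (a n).ofLp = (A n)ᵀ *ᵥ t.ofLp := fun n => by
    simp only [ha]
    rw [Matrix.mulVec_mulVec, Matrix.mul_nonsing_inv _ (hcov n).det_pos.ne'.isUnit,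
      Matrix.one_mulVec]
  have hVeq : ∀ n, (a n).ofLp ⬝ᵥ covMat (ξ n) *ᵥ (a n).ofLp =
      t.ofLp ⬝ᵥ (A n * (covMat (ξ n))⁻¹ * (A n)ᵀ) *ᵥ t.ofLp := fun n => by
    rw [hcova, ← Matrix.mulVec_mulVec, ← Matrix.mulVec_mulVec, Matrix.dotProduct_mulVec,
      Matrix.vecMul_transpose, dotProduct_comm]
  have hV : Tendsto (fun n => (a n).ofLp ⬝ᵥ covMat (ξ n) *ᵥ (a n).ofLp) atTop
      (𝓝 (t.ofLp ⬝ᵥ G *ᵥ t.ofLp)) := by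
    simp only [hVeq]
    exact tendsto_dotProduct_mulVec hG t
  have hanorm : ∀ᶠ n in atTop, ‖a n‖ ≤ C * ‖t‖ / c := by
    filter_upwards [hcoer] with n hn
    refine (hn.norm_le hc (v := WithLp.toLp 2 ((A n)ᵀ *ᵥ t.ofLp)) (hcova n)).trans ?_
    refine div_le_div_of_nonneg_right ((norm_mulVec_le _ _).trans ?_) hc.le
    rw [normF_transpose]
    exact mul_le_mul_of_nonneg_right (hA n) (norm_nonneg _)
  have hmn : Tendsto (fun n : ℕ => ((n - s n : ℕ) : ℝ) / n) atTop (𝓝 1) := by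
    have h1 := hs.tendsto_div_nhds_zero.const_sub 1
    rw [sub_zero] at h1
    refine h1.congr' ?_
    filter_upwards [eventually_gt_atTop 0] with n hn
    have : (n : ℝ) ≠ 0 := by positivity
    rw [Nat.cast_sub (hsn n), sub_div, div_self this]
  have hmn' : Tendsto (fun n : ℕ => (n : ℝ) / ((n - s n : ℕ) : ℝ)) atTop (𝓝 1) := by
    simpa using hmn.inv₀ one_ne_zero
  have hmτ : Tendsto (fun n => ((n - s n : ℕ) : ℝ) * τ n ^ 2) atTop (𝓝 1) := by
    refine hmn'.congr fun n => ?_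
    simp only [hτ]
    rw [div_pow, Real.sq_sqrt (Nat.cast_nonneg n)]
    rcases eq_or_ne ((n - s n : ℕ) : ℝ) 0 with h | h
    · simp [h]
    · field_simp
  have hτeq : ∀ n : ℕ, τ n = (n : ℝ) / ((n - s n : ℕ) : ℝ) * (Real.sqrt n)⁻¹ := fun n => by
    simp only [hτ]
    rcases Nat.eq_zero_or_pos n with h | h
    · subst h; simp
    · have h0 : 0 < Real.sqrt n := Real.sqrt_pos.2 (by exact_mod_cast h)
      have : (n : ℝ) = Real.sqrt n * Real.sqrt n := (Real.mul_self_sqrt (Nat.cast_nonneg n)).symm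
      rw [div_mul_eq_mul_div]
      congr 1
      rw [eq_mul_inv_iff_mul_eq₀ h0.ne']
      exact this.symm
  have hτ0 : Tendsto τ atTop (𝓝 0) := by
    have h1 : Tendsto (fun n : ℕ => (Real.sqrt n)⁻¹) atTop (𝓝 0) :=
      tendsto_inv_atTop_zero.comp (Real.tendsto_sqrt_atTop.comp tendsto_natCast_atTop_atTop)
    have h2 := hmn'.mul h1
    rw [mul_zero] at h2
    exact h2.congr fun n => (hτeq n).symm
  have hτd : Tendsto (fun n => τ n * d n) atTop (𝓝 0) := by
    have h2 := hmn'.mul hdn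
    rw [mul_zero] at h2
    refine h2.congr fun n => ?_
    rw [hτeq]
    ring
  have hτnn : ∀ n, 0 ≤ τ n := fun n => by simp only [hτ]; positivity
  refine tendsto_integral_exp_pow (w := fun n x => inner ℝ (a n) x) (fun n => by fun_prop)
    (fun n => memLp_inner (hX2 n) (a n)) (fun n => integrable_abs_inner_pow_three (hX4 n) (a n))
    hν hν0 hτnn hτ0 hmτ ?_ ?_
  · simpa only [fun n => integral_inner_sq (hX2 n) (hX0 n) (a n)] using hV
  · have hup : Tendsto (fun n => (τ n * d n) * ((a n).ofLp ⬝ᵥ covMat (ξ n) *ᵥ (a n).ofLp +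
        (C * ‖t‖ / c) ^ 4 * K ^ 2)) atTop (𝓝 0) := by
      simpa using hτd.mul (hV.add_const ((C * ‖t‖ / c) ^ 4 * K ^ 2))
    refine tendsto_of_tendsto_of_tendsto_of_le_of_le' tendsto_const_nhds hup
      (Eventually.of_forall fun n => mul_nonneg (hτnn n)
        (integral_nonneg fun x => by positivity)) ?_
    filter_upwards [hanorm, hd.eventually_gt_atTop 0] with n hn hdpos
    rw [mul_assoc]
    refine mul_le_mul_of_nonneg_left
      ((integral_abs_inner_pow_three_le hdpos (hX4 n) (hX0 n) (a n)).trans ?_) (hτnn n)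
    rw [← mul_add]
    have h1 : kappaX (ξ n) ^ 2 ≤ K ^ 2 := by
      rw [← sq_abs]; exact pow_le_pow_left₀ (abs_nonneg _) (hK n) 2
    gcongr

end IncidentalRegression

open IncidentalRegression in
theorem theorem5p5
    -- the sample of size `n` lives on a probability space `(Ω n, P n)`
    {Ω : ℕ → Type*} [∀ n, MeasurableSpace (Ω n)]
    (P : (n : ℕ) → Measure (Ω n)) [∀ n, IsProbabilityMeasure (P n)]
    -- covariates with distribution `ξ n` in dimension `d n`; errors with fixed distribution `ν`
    (d : ℕ → ℕ)
    (ξ : (n : ℕ) → Measure (EuclideanSpace ℝ (Fin (d n)))) [∀ n, IsProbabilityMeasure (ξ n)]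
    (ν : Measure ℝ) [IsProbabilityMeasure ν] (σ : ℝ)
    (X : (n : ℕ) → Fin n → Ω n → EuclideanSpace ℝ (Fin (d n)))
    (ε : (n : ℕ) → Fin n → Ω n → ℝ)
    (hXlaw : ∀ n i, HasLaw (X n i) (ξ n) (P n))
    (hεlaw : ∀ n i, HasLaw (ε n i) ν (P n))
    (hXind : ∀ n, iIndepFun (X n) (P n))
    (hεind : ∀ n, iIndepFun (ε n) (P n))
    (hXε : ∀ n, IndepFun (fun ω i => X n i ω) (fun ω i => ε n i ω) (P n))
    (hX2 : ∀ n j, MemLp (fun x => x j) 2 (ξ n))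
    (hXmean : ∀ n j, ∫ x, x j ∂(ξ n) = 0)
    (hXcov : ∀ n, (covMat (ξ n)).PosDef)
    (hε2 : MemLp id 2 ν) (hεmean : ∫ x, x ∂ν = 0) (hεvar : Var[id; ν] = σ ^ 2)
    -- the bounds `κ n` and `γ n` on covariates and errors
    (κ γ : ℕ → ℝ) (hκpos : ∀ n, 0 < κ n) (hγpos : ∀ n, 0 < γ n)
    (hκn : κ =o[atTop] fun n => Real.sqrt n) (hγn : γ =o[atTop] fun n => Real.sqrt n)
    (hκ : Tendsto (fun n => P n {ω | ∃ i, κ n < ‖X n i ω‖}) atTop (𝓝 0))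
    (hγ : Tendsto (fun n => P n {ω | ∃ i, γ n < |ε n i ω|}) atTop (𝓝 0))
    -- incidental parameters: `s₁` large ones, then `s₂` nonzero bounded ones, then zeros
    (s₁ s₂ : ℕ → ℕ) (μstar : (n : ℕ) → Fin n → ℝ)
    (hs : ∀ n, s₁ n + s₂ n ≤ n)
    (hs₁n : (fun n => (s₁ n : ℝ)) =o[atTop] fun n => (n : ℝ))
    (hs₂n : (fun n => (s₂ n : ℝ)) =o[atTop] fun n => (n : ℝ))
    (hlarge : MuchLessThanLarge (fun n => max (κ n) (γ n)) s₁ μstar)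
    (hbdd : ∀ n (i : Fin n), s₁ n ≤ i.val → i.val < s₁ n + s₂ n →
      μstar n i ≠ 0 ∧ |μstar n i| ≤ γ n)
    (hzero : ∀ n (i : Fin n), s₁ n + s₂ n ≤ i.val → μstar n i = 0)
    -- structural parameters and diverging dimension
    (βstar : (n : ℕ) → EuclideanSpace ℝ (Fin (d n)))
    (hd : Tendsto d atTop atTop)
    (hdn : (fun n => (d n : ℝ)) =o[atTop] fun n => (n : ℝ))
    -- the regularization parameter
    (lam : ℕ → ℝ) (α : ℝ) (hα : 2 < α)
    (hlamκ : (fun n => Real.sqrt (d n) * κ n) =o[atTop] lam)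
    (hlamγ : ∀ n, α * γ n ≤ lam n)
    (hlamμ : MuchLessThanLarge lam s₁ μstar)
    -- (B1'), (B2), (C)
    (hB1 : AwayFromZero fun n => lamMin (covMat (ξ n)))
    (hB2 : BoundedSeq fun n => normFd (covMat (ξ n)))
    (hX4 : ∀ n j, MemLp (fun x => x j) 4 (ξ n))
    (hC : BoundedSeq fun n => kappaX (ξ n))
    -- (D)
    (q : ℕ) (A : (n : ℕ) → Matrix (Fin q) (Fin (d n)) ℝ) (GX : Matrix (Fin q) (Fin q) ℝ)
    (hGXsymm : GX.IsSymm)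
    (hA : BoundedSeq fun n => normF (A n))
    (hG : BoundedSeq fun n => lamMax (A n * (A n)ᵀ))
    (hGX : Tendsto (fun n => normF (A n * (covMat (ξ n))⁻¹ * (A n)ᵀ - GX)) atTop (𝓝 0))
    -- (E)
    (hE1 : BoundedSeq fun n => sigmaXMax (ξ n))
    (hE2 : BoundedSeq fun n => gammaXMax (ξ n))
    (hE3 : AwayFromZero fun n => sigmaXMin (ξ n))
    -- rates of the dimension and of the number of bounded incidental parameters
    (hrate : (fun n => (d n : ℝ) ^ 5 * Real.log (d n)) =o[atTop] fun n => (n : ℝ))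
    (hs₂ : (fun n => (s₂ n : ℝ)) =o[atTop]
      fun n => Real.sqrt n / (Real.sqrt (d n) * κ n * γ n))
    -- the penalized estimator `(μ̂, β̂)`: a minimizer of the penalized loss
    (μhat : (n : ℕ) → Ω n → Fin n → ℝ)
    (βhat : (n : ℕ) → Ω n → EuclideanSpace ℝ (Fin (d n)))
    (hμhat : ∀ n, AEMeasurable (μhat n) (P n))
    (hmin : ∀ n, ∀ᵐ ω ∂(P n), IsMinOn
      (penalizedLoss (lam n) (fun i => X n i ω)
        (response (μstar n) (fun i => X n i ω) (βstar n) (fun i => ε n i ω)))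
      Set.univ (μhat n ω, βhat n ω)) :
    -- `√n A_n (β̃ - β⋆)` converges in distribution to `N(0, σ² G_X)`
    TendstoInDistribution
      (fun (n : ℕ) ω => WithLp.toLp 2 (Real.sqrt n • (A n *ᵥ
        (twoStep (fun i => X n i ω)
          (response (μstar n) (fun i => X n i ω) (βstar n) (fun i => ε n i ω))
          (μhat n ω) - βstar n).ofLp)))
      atTop (id : EuclideanSpace ℝ (Fin q) → EuclideanSpace ℝ (Fin q)) P
      (multivariateGaussian 0 (σ ^ 2 • GX)) := by
  obtain ⟨g, h, hg4, hh8, hgsq, hhsq, hg1, hh1, -, hhT, hθ⟩ := exists_scales hd hrate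
  obtain ⟨c, hc, hcev⟩ := hB1
  obtain ⟨K, hK⟩ := hC
  obtain ⟨C, hC⟩ := hA
  have hAle : ∀ n, normF (A n) ≤ C := fun n => (le_abs_self _).trans (hC n)
  have hC0 : 0 ≤ C := (normF_nonneg _).trans (hAle 0)
  have hKle : ∀ n, kappaX (ξ n) ≤ K := fun n => (le_abs_self _).trans (hK n)
  have hK0 : 0 ≤ K := (abs_nonneg _).trans (hK 0)
  have hκX0 : ∀ n, 0 ≤ kappaX (ξ n) := fun n => by unfold kappaX; positivity
  have hsymm : ∀ n, (covMat (ξ n)).IsSymm := fun n => by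
    have := (hXcov n).isHermitian
    rwa [Matrix.IsHermitian, Matrix.conjTranspose_eq_transpose_of_trivial] at this
  have hcoer : ∀ᶠ n in atTop, Coercive c (covMat (ξ n)) := by
    filter_upwards [hcev] with n hn
    exact coercive_of_le_lamMin (hXcov n).isHermitian hn
  -- the pairs of covariates and errors
  set U : (n : ℕ) → Fin n → Ω n → EuclideanSpace ℝ (Fin (d n)) × ℝ :=
    fun n i ω => (X n i ω, ε n i ω) with hU
  have hUind : ∀ n, iIndepFun (U n) (P n) := fun n =>
    iIndepFun_pair (fun i => (hXlaw n i).aemeasurable) (fun i => (hεlaw n i).aemeasurable)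
      (hXind n) (hεind n) (hXε n)
  have hUlaw : ∀ n i, HasLaw (U n i) ((ξ n).prod ν) (P n) := fun n i =>
    hasLaw_pair (hXlaw n i) (hεlaw n i)
      ((hXε n).comp (φ := fun x : Fin n → EuclideanSpace ℝ (Fin (d n)) => x i)
        (ψ := fun y : Fin n → ℝ => y i) (measurable_pi_apply i) (measurable_pi_apply i))
  set S := ∫ y, y ^ 2 ∂ν with hS
  have hSσ : S = σ ^ 2 := by
    rw [← hεvar, variance_eq_integral hε2.aemeasurable]
    simp [hεmean, hS]
  -- the two-step estimator and its linear part
  set T : (n : ℕ) → Ω n → EuclideanSpace ℝ (Fin q) := fun n ω =>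
    WithLp.toLp 2 (Real.sqrt n • (A n *ᵥ (twoStep (fun i => X n i ω)
      (response (μstar n) (fun i => X n i ω) (βstar n) (fun i => ε n i ω))
      (μhat n ω) - βstar n).ofLp)) with hT
  set W : (n : ℕ) → Ω n → EuclideanSpace ℝ (Fin q) := fun n ω =>
    linearPart (s₁ n) (A n) (covMat (ξ n)) (fun i => X n i ω) (fun i => ε n i ω) with hW
  have hXe : ∀ n, AEMeasurable (fun ω => ((fun i => X n i ω), fun i => ε n i ω)) (P n) :=
    fun n => (aemeasurable_pi_lambda _ fun i => (hXlaw n i).aemeasurable).prodMk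
      (aemeasurable_pi_lambda _ fun i => (hεlaw n i).aemeasurable)
  have hTm : ∀ n, AEMeasurable (T n) (P n) := by
    intro n
    have h1 : Measurable fun p : (Fin n → EuclideanSpace ℝ (Fin (d n))) × (Fin n → ℝ) =>
        (p.1, response (μstar n) p.1 (βstar n) p.2) := by
      refine measurable_fst.prodMk (measurable_pi_lambda _ fun i => ?_)
      unfold response
      fun_prop
    have h2 : AEMeasurable (fun ω => twoStep (fun i => X n i ω)
        (response (μstar n) (fun i => X n i ω) (βstar n) (fun i => ε n i ω)) (μhat n ω)) (P n) := by
      have h5 := measurable_twoStep.comp_aemeasurable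
        ((h1.comp_aemeasurable (hXe n)).prodMk (hμhat n))
      exact h5
    have h3 : Continuous fun b : EuclideanSpace ℝ (Fin (d n)) =>
        (WithLp.toLp 2 (Real.sqrt n • (A n *ᵥ (b - βstar n).ofLp)) :
          EuclideanSpace ℝ (Fin q)) := by
      have h4 : Continuous fun b : EuclideanSpace ℝ (Fin (d n)) => A n *ᵥ (b - βstar n).ofLp :=
        continuous_const.matrix_mulVec (by fun_prop)
      exact (PiLp.continuous_toLp 2 _).comp (h4.fun_const_smul (Real.sqrt n))
    have h6 := h3.measurable.comp_aemeasurable h2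
    exact h6
  have hWm : ∀ n, AEMeasurable (W n) (P n) := fun n => by
    have h1 := (measurable_linearPart (s₁ n) (A n) (covMat (ξ n))).comp_aemeasurable (hXe n)
    exact h1
  -- the unfavourable samples
  set B : (n : ℕ) → Set (Ω n) := fun n =>
    {ω | ∃ i, κ n < ‖X n i ω‖} ∪ {ω | ∃ i, γ n < |ε n i ω|} ∪
    {ω | ∃ i, g n * h n ^ 5 < ‖X n i ω‖} ∪
    {ω | g n ^ 2 * h n ^ 5 < ‖∑ i ∈ smallIdx n (s₁ n), ε n i ω • X n i ω‖} ∪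
    {ω | g n ^ 2 * h n ^ 5 < ‖∑ i ∈ largeIdx n (s₁ n), sgn (μstar n i) • X n i ω‖} ∪
    {ω | g n ^ 2 * h n ^ 9 < normF (gram (fun i => X n i ω) (smallIdx n (s₁ n)) -
      ((n - s₁ n : ℕ) : ℝ) • covMat (ξ n))} with hB
  have hhinv : ∀ k : ℕ, k ≠ 0 → ∀ D : ℝ, Tendsto (fun n => D / h n ^ k) atTop (𝓝 0) :=
    fun k hk D => ((tendsto_pow_atTop hk).comp hhT).const_div_atTop D
  have hBlim : Tendsto (fun n => P n (B n)) atTop (𝓝 0) := by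
    have p1 : Tendsto (fun n => P n {ω | ∃ i, g n * h n ^ 5 < ‖X n i ω‖}) atTop (𝓝 0) := by
      refine tendsto_zero_of_le_ofReal (f := fun n => K ^ 2 / h n ^ 4) ?_ (hhinv 4 (by simp) _)
      filter_upwards [hg1, hh1] with n hgn hhn
      have hg0 : 0 < g n := by linarith
      have hh0 : 0 < h n := by linarith
      refine (measure_exists_norm_gt_le (hXlaw n) (hX4 n) (by positivity)).trans
        (ENNReal.ofReal_le_ofReal ?_)
      rw [← hg4, ← hh8]
      have := hKle n
      have := hκX0 n
      calc _ ≤ g n ^ 4 * (h n ^ 8 * K) ^ 2 / (g n * h n ^ 5) ^ 4 := by gcongr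
        _ = _ := by field_simp
    have p2 : Tendsto (fun n => P n {ω | g n ^ 2 * h n ^ 5 <
        ‖∑ i ∈ smallIdx n (s₁ n), ε n i ω • X n i ω‖}) atTop (𝓝 0) := by
      refine tendsto_zero_of_le_ofReal (f := fun n => K * S / h n ^ 2) ?_ (hhinv 2 (by simp) _)
      filter_upwards [hg1, hh1] with n hgn hhn
      have hg0 : 0 < g n := by linarith
      have hh0 : 0 < h n := by linarith
      refine (measure_noise_le (hUind n) (hUlaw n) (hX4 n) hε2 hεmean _ (by positivity)).trans
        (ENNReal.ofReal_le_ofReal ?_)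
      rw [← hg4, ← hh8, ← hS]
      have := hKle n
      have hS0 : 0 ≤ S := hSσ ▸ sq_nonneg σ
      calc _ ≤ g n ^ 4 * (h n ^ 8 * K * S) / (g n ^ 2 * h n ^ 5) ^ 2 := by gcongr
        _ = _ := by field_simp
    have p3 : Tendsto (fun n => P n {ω | g n ^ 2 * h n ^ 5 <
        ‖∑ i ∈ largeIdx n (s₁ n), sgn (μstar n i) • X n i ω‖}) atTop (𝓝 0) := by
      refine tendsto_zero_of_le_ofReal (f := fun n => K / h n ^ 2) ?_ (hhinv 2 (by simp) _)
      filter_upwards [hg1, hh1] with n hgn hhn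
      have hg0 : 0 < g n := by linarith
      have hh0 : 0 < h n := by linarith
      refine (measure_signed_sum_le (hUind n) (hUlaw n) (hX4 n) (hXmean n)
        (fun i => (abs_sgn _).le) _ (by positivity)).trans (ENNReal.ofReal_le_ofReal ?_)
      rw [← hg4, ← hh8]
      have := hKle n
      calc _ ≤ g n ^ 4 * (h n ^ 8 * K) / (g n ^ 2 * h n ^ 5) ^ 2 := by gcongr
        _ = _ := by field_simp
    have p4 : Tendsto (fun n => P n {ω | g n ^ 2 * h n ^ 9 <
        normF (gram (fun i => X n i ω) (smallIdx n (s₁ n)) -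
          ((n - s₁ n : ℕ) : ℝ) • covMat (ξ n))}) atTop (𝓝 0) := by
      refine tendsto_zero_of_le_ofReal (f := fun n => K ^ 2 / h n ^ 2) ?_ (hhinv 2 (by simp) _)
      filter_upwards [hg1, hh1] with n hgn hhn
      have hg0 : 0 < g n := by linarith
      have hh0 : 0 < h n := by linarith
      have hb := measure_gram_le (hUind n) (hUlaw n) (hX4 n) (hXmean n) (smallIdx n (s₁ n))
        (M := g n ^ 2 * h n ^ 9) (by positivity)
      rw [card_smallIdx] at hb
      refine hb.trans (ENNReal.ofReal_le_ofReal ?_)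
      rw [← hg4, ← hh8]
      have := hKle n
      have := hκX0 n
      calc _ ≤ g n ^ 4 * (h n ^ 8 * K) ^ 2 / (g n ^ 2 * h n ^ 9) ^ 2 := by gcongr
        _ = _ := by field_simp
    have hsum := ((((hκ.add hγ).add p1).add p2).add p3).add p4
    simp only [add_zero] at hsum
    refine tendsto_of_tendsto_of_tendsto_of_le_of_le tendsto_const_nhds hsum
      (fun _ => zero_le) fun n => ?_
    refine (measure_union_le _ _).trans (add_le_add ?_ le_rfl)
    refine (measure_union_le _ _).trans (add_le_add ?_ le_rfl)
    refine (measure_union_le _ _).trans (add_le_add ?_ le_rfl)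
    refine (measure_union_le _ _).trans (add_le_add ?_ le_rfl)
    exact measure_union_le _ _
  -- on favourable samples the estimator is close to its linear part
  set r : ℕ → ℝ := fun n => C * (4 / c) * (1 / h n ^ 4 + 2 / c * (h n ^ 10 / g n) ^ 2) with hr
  have hrlim : Tendsto r atTop (𝓝 0) := by
    have := ((hhinv 4 (by simp) 1).add ((hθ.pow 2).const_mul (2 / c))).const_mul (C * (4 / c))
    rw [zero_pow two_ne_zero, mul_zero, add_zero, mul_zero] at this
    exact this
  have hclose : ∀ᶠ n in atTop, 0 ≤ r n ∧ ∀ᵐ ω ∂(P n), ω ∉ B n → ‖T n ω - W n ω‖ ≤ r n := by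
    have hα0 : 0 < (1 - 2 / α) / 2 := by
      have : 2 / α < 1 := (div_lt_one (by linarith)).2 hα
      linarith
    have hθ1 : ∀ᶠ n in atTop, 6 * (h n ^ 10 / g n) < c * ((1 - 2 / α) / 2) / 4 := by
      have := hθ.const_mul 6
      rw [mul_zero] at this
      exact this.eventually (gt_mem_nhds (by positivity))
    have hθ2 : ∀ᶠ n in atTop, h n ^ 10 / g n < c / 4 :=
      hθ.eventually (gt_mem_nhds (by positivity))
    filter_upwards [hg1, hh1, hcoer, hθ1, hθ2, hs₁n.def (c := 1 / 2) (by norm_num),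
      hlamκ.def (c := 1) one_pos, hs₂.def (c := 1) one_pos,
      hlamμ (1 / 3) (by norm_num), eventually_gt_atTop 0]
      with n hgn hhn hcn hθ1n hθ2n hsn hlκn hs2n hlarge_n hn
    have hg0 : 0 < g n := by linarith
    have hh0 : 0 < h n := by linarith
    have hγ0 := hγpos n
    have hκ0 := hκpos n
    have hlam0 : 0 < lam n := lt_of_lt_of_le (by positivity) (hlamγ n)
    have hnR : (0 : ℝ) < n := by exact_mod_cast hn
    have hm : g n ^ 4 / 2 ≤ ((n - s₁ n : ℕ) : ℝ) := by
      rw [Nat.cast_sub ((Nat.le_add_right _ _).trans (hs n)), hg4]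
      simp only [Real.norm_eq_abs, Nat.abs_cast] at hsn
      linarith
    have hm0 : 0 < n - s₁ n := by
      have : (0 : ℝ) < ((n - s₁ n : ℕ) : ℝ) := lt_of_lt_of_le (by positivity) hm
      exact_mod_cast this
    have hκl : h n ^ 4 * κ n ≤ lam n := by
      rw [Real.norm_eq_abs, Real.norm_eq_abs, abs_of_pos hlam0, one_mul, hhsq] at hlκn
      exact (le_abs_self _).trans hlκn
    have hsκ : (s₂ n : ℝ) * γ n * κ n ≤ g n ^ 2 / h n ^ 4 := by
      rw [Real.norm_eq_abs, Real.norm_eq_abs, Nat.abs_cast, one_mul, hhsq, hgsq,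
        abs_of_pos (by positivity), le_div_iff₀ (by positivity)] at hs2n
      rw [le_div_iff₀ (by positivity)]
      linarith
    have hkpos : 0 < min (κ n) (g n * h n ^ 5) := lt_min hκ0 (by positivity)
    refine ⟨by simp only [hr]; positivity, ?_⟩
    filter_upwards [hmin n] with ω hω hωB
    simp only [hB, Set.mem_union, Set.mem_ofPred_eq, not_or, not_exists, not_lt] at hωB
    obtain ⟨⟨⟨⟨⟨b1, b2⟩, b3⟩, b4⟩, b5⟩, b6⟩ := hωB
    have hbdd' : ∀ i : Fin n, s₁ n ≤ i.val → |μstar n i| ≤ γ n := by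
      intro i hi
      by_cases hi2 : i.val < s₁ n + s₂ n
      · exact (hbdd n i hi hi2).2
      · rw [hzero n i (not_lt.1 hi2), abs_zero]; exact hγ0.le
    have hdet := norm_twoStep_sub_linearPart_le (s₂ := s₂ n) (βh := βhat n ω) hα hγ0 (hlamγ n)
      hkpos (fun i => le_min (b1 i) (b3 i)) b2
      (fun i hi => by linarith [hlarge_n i hi]) hbdd' (hzero n) hcn hc hm0 b6 ?_ b4 b5 ?_
      (hAle n) hω
    · refine hdet.trans ?_
      rw [hgsq]
      exact linearization_rate_le hgn hhn hc hγ0 (Nat.cast_nonneg _) hC0 (min_le_left _ _) hsκ hm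
    · have h1 : h n ^ 9 ≤ h n ^ 10 := pow_le_pow_right₀ hhn (by norm_num)
      have h2 : h n ^ 10 < c / 4 * g n := (div_lt_iff₀ hg0).1 hθ2n
      have h3 : g n ≤ g n ^ 2 := le_self_pow₀ hgn (by norm_num)
      calc g n ^ 2 * h n ^ 9 ≤ g n ^ 2 * (c / 4 * g n ^ 2) := by
            have : h n ^ 9 ≤ c / 4 * g n ^ 2 := by
              have : c / 4 * g n ≤ c / 4 * g n ^ 2 := by gcongr
              linarith
            gcongr
        _ = g n ^ 4 / 2 * c / 2 := by ring
        _ ≤ _ := by gcongr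
    · exact detection_rate_lt hgn hhn hc hα0 hγ0 (Nat.cast_nonneg _) hkpos (min_le_left _ _)
        (min_le_right _ _) hκl hsκ hm hθ1n
  -- conclusion by characteristic functions
  have hdn' : Tendsto (fun n : ℕ => (d n : ℝ) / Real.sqrt n) atTop (𝓝 0) := by
    have h2 := hθ.pow 2
    rw [zero_pow (by norm_num)] at h2
    refine tendsto_of_tendsto_of_tendsto_of_le_of_le' tendsto_const_nhds h2
      (Eventually.of_forall fun n => by positivity) ?_
    filter_upwards [hh1] with n hhn
    rw [hgsq, ← hh8, div_pow, ← pow_mul]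
    have : h n ^ 8 ≤ h n ^ (10 * 2) := pow_le_pow_right₀ hhn (by norm_num)
    gcongr
  have hGpsd : GX.PosSemidef := posSemidef_of_tendsto hGXsymm hGX fun n t => by
    have := ((hXcov n).inv.posSemidef.mul_mul_conjTranspose_same (A n)).dotProduct_mulVec_nonneg t
    simpa [Matrix.conjTranspose_eq_transpose_of_trivial] using this
  have hσGpsd : (σ ^ 2 • GX).PosSemidef := hGpsd.smul (sq_nonneg σ)
  refine ⟨hTm, aemeasurable_id, ?_⟩
  refine ProbabilityMeasure.tendsto_iff_tendsto_charFun.2 fun t => ?_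
  have hWlim := tendsto_charFun_linearPart hUind hUlaw hX4 hXmean hXcov hε2 hεmean
    (fun n => (Nat.le_add_right _ _).trans (hs n)) hs₁n hd hdn' hc hcoer hK hAle hGX t
  have hdiff : Tendsto (fun n => charFun ((P n).map (T n)) t - charFun ((P n).map (W n)) t)
      atTop (𝓝 0) := by
    have hB' := (ENNReal.tendsto_toReal ENNReal.zero_ne_top).comp hBlim
    have hup : Tendsto (fun n => r n * ‖t‖ + 2 * (P n (B n)).toReal) atTop (𝓝 0) := by
      simpa using (hrlim.mul_const ‖t‖).add (hB'.const_mul 2)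
    refine squeeze_zero_norm' ?_ hup
    filter_upwards [hclose] with n hn
    exact norm_charFun_sub_le (hTm n) (hWm n) (B n) hn.1 hn.2 t
  have hlim := hdiff.add hWlim
  simp only [ProbabilityMeasure.coe_mk, Measure.map_id]
  rw [charFun_multivariateGaussian hσGpsd]
  refine (hlim.congr fun n => sub_add_cancel _ _).trans (le_of_eq ?_)
  rw [zero_add, inner_zero_right, ← hS, hSσ, Matrix.smul_mulVec, dotProduct_smul, smul_eq_mul]
  congr 2
  push_cast
  ring
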